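/- **Setting.** Let $K$ be a field of characteristic $0$ (for instance $K=\mathbb{Q}$). For $n\ge 2$ let $A_\infty(n)=C_*(K(n),K)$ be the cellular chain complex of the $n$-th associahedron. It is the $K$-vector space generated by pairs $(T,\omega)$, where $T$ is a planar rooted tree with $n$ leaves whose internal vertices all have at least two inputs and $\omega$ is an orientation of the vector space spanned by the internal edges of $T$, modulo $(T,-\omega)=-(T,\omega)$. The degree of $(T,\omega)$ is $n-2$ minus the number of internal edges of $T$. The differential is $$\partial(U,\sigma)=\sum_{V/e=U}(V,e\wedge\sigma),$$ summed over all trees $V$ with an internal edge $e$ whose contraction gives $U$. For $1\le i\le m$ and $U$, $V$ with $m$ and $n$ leaves, the operadic composition is $$(U,\sigma)\circ_i(V,\tau)=(-1)^{i(n+1)+m|V|}\,(U\circ_iV,\ \sigma\wedge\tau\wedge e),$$ where the root of $V$ is grafted to the $i$-th leaf of $U$ and $e$ is the new edge. The generator $r$ of $\mathbb{Z}/(n+1)\mathbb{Z}$ acts on $A_\infty(n)$ by $r(T,\sigma)=(-1)^n(r(T),\sigma)$, where $r(T)$ is obtained from $T$ by the rotation that turns leaf $j<n$ into leaf $j+1$,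 leaf $n$ into the root, and the root into leaf $1$. Let $c_n$ be the corolla with $n$ leaves. The operad $A_\infty\otimes A_\infty$ is given by $(A_\infty\otimes A_\infty)(n)=A_\infty(n)\otimes A_\infty(n)$ with $$\partial(U_1\otimes U_2)=\partial U_1\otimes U_2+(-1)^{|U_1|}U_1\otimes\partial U_2,\qquad (U_1\otimes U_2)\circ_i(V_1\otimes V_2)=(-1)^{|U_2||V_1|}(U_1\circ_iV_1)\otimes(U_2\circ_iV_2).$$ Let $\mathcal{A}s$ be the non-unital, non-symmetric associative operad, $\mathcal{A}s(n)=K\mu_n$ for $n\ge 2$, where $\mu_n$ is the $n$-fold product. Its canonical diagonal is $\mu_n\mapsto\mu_n\otimes\mu_n$, and the canonical isomorphism of operads $\mathcal{A}s\cong H_*(A_\infty)$ is the one that sends $\mu_2$ to $[c_2]$. **Theorem.** The operad $A_\infty$ admits a cyclic diagonal. That is, there are linear maps $\Delta\colon A_\infty(n)\to A_\infty(n)\otimes A_\infty(n)$ for $n\ge2$ such that 1. $\Delta$ is a morphism of dg operads: it has degree $0$, $\Delta\partial=\partial\Delta$, and $\Delta(x\circ_iy)=\Delta(x)\circ_i\Delta(y)$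 for all $x\in A_\infty(m)$, $y\in A_\infty(n)$ and $1\le i\le m$; 2. the induced map $H_*(A_\infty)\to H_*(A_\infty\otimes A_\infty)\cong H_*(A_\infty)\otimes H_*(A_\infty)$ is the canonical diagonal of $\mathcal{A}s$ under the canonical isomorphism $H_*(A_\infty)\cong\mathcal{A}s$; 3. $\Delta$ commutes with the cyclic actions: $\Delta\circ r=(r\otimes r)\circ\Delta$. -/

import Mathlib

open scoped TensorProduct

namespace AInfinity

/-! ### Planar rooted trees -/

/-- An internal edge of a planar rooted tree whose leaves are numbered `1, 2, …, n` from left to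
right. It is recorded by the leaves lying above it, which form an interval
`{first, first + 1, …, last}`. -/
@[ext]
structure Edge where
  first : ℕ
  last : ℕ
  deriving DecidableEq

/-- Auxiliary total (lexicographic) order on edges; it only serves to pick, for every tree, one
reference ordering of its edges. -/
instance : LinearOrder Edge :=
  LinearOrder.lift' (fun e : Edge => toLex (e.first, e.last)) (by
    intro e f h
    have h' : (e.first, e.last) = (f.first, f.last) := toLex.injective h
    ext
    · exact congrArg Prod.fst h'
    · exact congrArg Prod.snd h')

/-- `e` can occur as an internal edge of a tree with `n` leaves: at least two leaves lie above it,
but not all of them (the interval `{1, …, n}` belongs to the root, which is not an internal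
edge). -/
def Edge.IsInternal (n : ℕ) (e : Edge) : Prop :=
  1 ≤ e.first ∧ e.first < e.last ∧ e.last ≤ n ∧ ¬(e.first = 1 ∧ e.last = n)

/-- Two edges can occur in the same tree: their intervals of leaves are nested or disjoint. -/
def Edge.Compatible (e f : Edge) : Prop :=
  (e.first ≤ f.first ∧ f.last ≤ e.last) ∨ (f.first ≤ e.first ∧ e.last ≤ f.last) ∨
    e.last < f.first ∨ f.last < e.first

/-- `s` is the set of internal edges of a planar rooted tree with `n ≥ 2` leaves, all of whose
internal vertices have at least two inputs. -/
def IsTree (n : ℕ) (s : Finset Edge) : Prop :=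
  2 ≤ n ∧ (∀ e ∈ s, e.IsInternal n) ∧ ∀ e ∈ s, ∀ f ∈ s, e.Compatible f

/-- Planar rooted trees with `n` leaves and all internal vertices of at least two inputs, i.e. the
cells of the associahedron `K(n)`. Such a tree is determined by its set of internal edges
(equivalently, by the corresponding partial bracketing of `n` letters). Contracting an internal
edge removes it from the set. There are no trees for `n < 2`. -/
def PlanarTree (n : ℕ) : Type := {s : Finset Edge // IsTree n s}

namespace PlanarTree

variable {n : ℕ}

/-- The internal edges of `T`, listed in the reference order. -/
def edgeList (T : PlanarTree n) : List Edge := T.1.sort (· ≤ ·)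

/-- The dimension of the cell of `K(n)` given by `T`: `n - 2` minus the number of internal
edges. -/
def deg (T : PlanarTree n) : ℤ := (n : ℤ) - 2 - (T.1.card : ℤ)

end PlanarTree

/-! ### The chain complexes `A∞(n)` -/

noncomputable section

variable (K : Type*) [Field K]

/-- `A∞(n)`, the cellular chains of `K(n)`. It is the vector space generated by the pairs `(T, ω)`
of a tree `T` and an orientation `ω` of the space spanned by its internal edges, modulo
`(T, -ω) = -(T, ω)`. So it has one basis vector for every tree `T`: the pair of `T` and the
reference orientation `e₁ ∧ ⋯ ∧ eₖ`, for `e₁ < ⋯ < eₖ` the edges of `T`. -/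
def AInf (n : ℕ) : Type _ := PlanarTree n →₀ K

instance (n : ℕ) : AddCommGroup (AInf K n) := inferInstanceAs (AddCommGroup (PlanarTree n →₀ K))

instance (n : ℕ) : Module K (AInf K n) := inferInstanceAs (Module K (PlanarTree n →₀ K))

/-- The basis of `A∞(n)` given by the trees. -/
def treeBasis (n : ℕ) : Module.Basis (PlanarTree n) K (AInf K n) :=
  .ofRepr (LinearEquiv.refl K (PlanarTree n →₀ K))

variable {K} in
/-- The basis vector of a tree, with its reference orientation. -/
def gen {n : ℕ} (T : PlanarTree n) : AInf K n := treeBasis K n T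

/-- The sign of the permutation that sorts a list of distinct edges: `-1` to the number of
inversions. -/
def orderSign : List Edge → K
  | [] => 1
  | e :: l => (-1) ^ (l.countP fun f => decide (f < e)) * orderSign l

open Classical in
/-- The element `(T, e₁ ∧ ⋯ ∧ eₖ)` of `A∞(n)`, where `e₁, …, eₖ` are the internal edges of the
tree `T`, listed without repetition in any order. (It is `0` if the list is not of this kind.) -/
def oriented (n : ℕ) (l : List Edge) : AInf K n :=
  if h : l.Nodup ∧ IsTree n l.toFinset then
    orderSign K l • gen ⟨l.toFinset, h.2⟩
  else 0

/-- The corolla `c_n`, the tree with no internal edges. -/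
def corolla (n : ℕ) : AInf K n := oriented K n []

/-- The chains of degree `k` in `A∞(n)`. -/
def piece (n : ℕ) (k : ℤ) : Submodule K (AInf K n) :=
  Submodule.span K {x | ∃ T : PlanarTree n, T.deg = k ∧ x = gen T}

/-- The differential `∂(U, σ) = ∑ (V, e ∧ σ)`, summed over all trees `V` with an edge `e` such that
`V / e = U`. (Pairs `(a, b)` that are not an edge, or an edge of `U`, or not compatible with the
edges of `U`, contribute `0`.) -/
def diff (n : ℕ) : AInf K n →ₗ[K] AInf K n :=
  (treeBasis K n).constr K fun U =>
    ∑ a ∈ Finset.Icc 1 n, ∑ b ∈ Finset.Icc 1 n, oriented K n (⟨a, b⟩ :: U.edgeList)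

/-- The operator `x ↦ (-1)^|x| x`. -/
def signOp (n : ℕ) : AInf K n →ₗ[K] AInf K n :=
  (treeBasis K n).constr K fun U => (-1 : K) ^ U.deg • gen U

/-! ### Operadic composition and cyclic action -/

/-- The edge of `U ∘_i V` coming from the edge `e` of `U`, where `V` has `n` leaves: the leaf `i` is
replaced by the leaves `i, …, i + n - 1`, and the leaves `j > i` are shifted to `j + n - 1`. -/
def Edge.outer (i n : ℕ) (e : Edge) : Edge :=
  ⟨if e.first ≤ i then e.first else e.first + n - 1,
    if e.last < i then e.last else e.last + n - 1⟩

/-- The edge of `U ∘_i V` coming from the edge `e` of `V`. -/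
def Edge.inner (i : ℕ) (e : Edge) : Edge := ⟨e.first + i - 1, e.last + i - 1⟩

/-- The composition `∘_i : A∞(m) ⊗ A∞(n) → A∞(m + n - 1)`, for `1 ≤ i ≤ m`:
`(U, σ) ∘_i (V, τ) = (-1)^(i (n + 1) + m |V|) (U ∘_i V, σ ∧ τ ∧ e)`, where the root of `V` is grafted
to the `i`-th leaf of `U` and `e` is the new edge. -/
def circ (m n i : ℕ) : AInf K m →ₗ[K] AInf K n →ₗ[K] AInf K (m + n - 1) :=
  (treeBasis K m).constr K fun U => (treeBasis K n).constr K fun V =>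
    (-1 : K) ^ ((i : ℤ) * (n + 1) + m * V.deg) •
      oriented K (m + n - 1)
        (U.edgeList.map (Edge.outer i n) ++ V.edgeList.map (Edge.inner i) ++ [⟨i, i + n - 1⟩])

/-- Rotation of a tree with `n` leaves: the leaf `j < n` becomes the leaf `j + 1`, the leaf `n`
becomes the root, and the root becomes the leaf `1`. An edge below the leaves `a, …, n` then
separates the leaves `1, …, a` from the remaining leaves and the root. -/
def Edge.rotate (n : ℕ) (e : Edge) : Edge :=
  if e.last = n then ⟨1, e.first⟩ else ⟨e.first + 1, e.last + 1⟩

/-- The generator `r` of the action of `ℤ / (n + 1)` on `A∞(n)`: `r (T, σ) = (-1)^n (r T, σ)`. -/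
def rot (n : ℕ) : AInf K n →ₗ[K] AInf K n :=
  (treeBasis K n).constr K fun T =>
    (-1 : K) ^ n • oriented K n (T.edgeList.map (Edge.rotate n))

/-! ### The operad `A∞ ⊗ A∞` -/

/-- `(A∞ ⊗ A∞)(n)`. -/
abbrev AInfSq (n : ℕ) : Type _ := AInf K n ⊗[K] AInf K n

/-- The chains of degree `k` in `A∞(n) ⊗ A∞(n)`. -/
def pieceSq (n : ℕ) (k : ℤ) : Submodule K (AInfSq K n) :=
  Submodule.span K {x | ∃ U V : PlanarTree n, U.deg + V.deg = k ∧ x = gen U ⊗ₜ[K] gen V}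

/-- `∂(x ⊗ y) = ∂x ⊗ y + (-1)^|x| x ⊗ ∂y`. -/
def diffSq (n : ℕ) : AInfSq K n →ₗ[K] AInfSq K n :=
  TensorProduct.map (diff K n) LinearMap.id + TensorProduct.map (signOp K n) (diff K n)

/-- `(U₁ ⊗ U₂) ∘_i (V₁ ⊗ V₂) = (-1)^(|U₂| |V₁|) (U₁ ∘_i V₁) ⊗ (U₂ ∘_i V₂)`. -/
def circSq (m n i : ℕ) : AInfSq K m →ₗ[K] AInfSq K n →ₗ[K] AInfSq K (m + n - 1) :=
  ((treeBasis K m).tensorProduct (treeBasis K m)).constr K fun U =>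
    ((treeBasis K n).tensorProduct (treeBasis K n)).constr K fun V =>
      (-1 : K) ^ (U.2.deg * V.1.deg) •
        (circ K m n i (gen U.1) (gen V.1) ⊗ₜ[K] circ K m n i (gen U.2) (gen V.2))

/-- `r ⊗ r`. -/
def rotSq (n : ℕ) : AInfSq K n →ₗ[K] AInfSq K n := TensorProduct.map (rot K n) (rot K n)

/-! ### Homology -/

section Homology

variable {K} {V W : Type*} [AddCommGroup V] [Module K V] [AddCommGroup W] [Module K W]

/-- The homology `ker d / im d` (total, over all degrees) of a differential `d`. -/
abbrev Homology (d : V →ₗ[K] V) : Type _ :=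
  LinearMap.ker d ⧸ (LinearMap.range d).submoduleOf (LinearMap.ker d)

/-- The homology class of a cycle. -/
def Homology.mk (d : V →ₗ[K] V) : LinearMap.ker d →ₗ[K] Homology d := Submodule.mkQ _

/-- The map induced on homology by a chain map. -/
def Homology.map {d : V →ₗ[K] V} {d' : W →ₗ[K] W} (f : V →ₗ[K] W)
    (hf : ∀ x, f (d x) = d' (f x)) : Homology d →ₗ[K] Homology d' :=
  Submodule.mapQ _ _
    (f.restrict (p := LinearMap.ker d) (q := LinearMap.ker d') (by
      intro x hx
      rw [LinearMap.mem_ker] at hx ⊢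
      rw [← hf, hx, map_zero]))
    (by
      rintro x ⟨y, hy⟩
      exact ⟨f y, by rw [← hf, hy]; rfl⟩)

end Homology

/-- `H_*(A∞(n))`. -/
abbrev HAInf (n : ℕ) : Type _ := Homology (diff K n)

/-- `H_*((A∞ ⊗ A∞)(n))`. -/
abbrev HSq (n : ℕ) : Type _ := Homology (V := AInfSq K n) (diffSq K n)

/-! ### The Künneth map -/

variable {K}

theorem oriented_mem_piece (n : ℕ) (l : List Edge) :
    oriented K n l ∈ piece K n ((n : ℤ) - 2 - l.length) := by
  unfold oriented
  split_ifs with h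
  · refine Submodule.smul_mem _ _ (Submodule.subset_span ⟨_, ?_, rfl⟩)
    simp [PlanarTree.deg, List.toFinset_card_of_nodup h.1]
  · exact Submodule.zero_mem _

theorem treeBasis_apply {n : ℕ} (T : PlanarTree n) : treeBasis K n T = gen T := rfl

theorem signOp_gen {n : ℕ} (T : PlanarTree n) :
    signOp K n (gen T) = (-1 : K) ^ T.deg • gen T := by
  rw [signOp, ← treeBasis_apply, Module.Basis.constr_basis, treeBasis_apply]

theorem diff_gen {n : ℕ} (U : PlanarTree n) :
    diff K n (gen U) =
      ∑ a ∈ Finset.Icc 1 n, ∑ b ∈ Finset.Icc 1 n, oriented K n (⟨a, b⟩ :: U.edgeList) := by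
  rw [diff, ← treeBasis_apply, Module.Basis.constr_basis]

theorem signOp_of_mem {n : ℕ} {k : ℤ} {x : AInf K n} (hx : x ∈ piece K n k) :
    signOp K n x = (-1 : K) ^ k • x := by
  induction hx using Submodule.span_induction with
  | mem x h =>
    obtain ⟨T, hT, rfl⟩ := h
    rw [signOp_gen, hT]
  | zero => simp
  | add x y _ _ hx hy => rw [map_add, hx, hy, smul_add]
  | smul a x _ hx => rw [map_smul, hx, smul_comm]

theorem diff_signOp (n : ℕ) (x : AInf K n) :
    diff K n (signOp K n x) = -signOp K n (diff K n x) := by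
  suffices h : diff K n ∘ₗ signOp K n = -(signOp K n ∘ₗ diff K n) from
    LinearMap.congr_fun h x
  refine (treeBasis K n).ext fun T => ?_
  have hd : diff K n (gen T) ∈ piece K n (T.deg - 1) := by
    rw [diff_gen]
    refine Submodule.sum_mem _ fun a _ => Submodule.sum_mem _ fun b _ => ?_
    have h := oriented_mem_piece (K := K) n (⟨a, b⟩ :: T.edgeList)
    have e : (n : ℤ) - 2 - ((⟨a, b⟩ :: T.edgeList : List Edge).length : ℤ) = T.deg - 1 := by
      simp only [List.length_cons, PlanarTree.edgeList, Finset.length_sort, PlanarTree.deg]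
      push_cast
      ring
    rwa [e] at h
  simp only [treeBasis_apply, LinearMap.comp_apply, LinearMap.neg_apply]
  rw [signOp_of_mem hd, signOp_gen, map_smul, ← neg_smul, zpow_sub₀ (by simp)]
  congr 1
  rw [zpow_one, div_neg, div_one, neg_neg]

theorem signOp_signOp (n : ℕ) (x : AInf K n) : signOp K n (signOp K n x) = x := by
  suffices h : signOp K n ∘ₗ signOp K n = LinearMap.id from LinearMap.congr_fun h x
  refine (treeBasis K n).ext fun T => ?_
  simp only [treeBasis_apply, LinearMap.comp_apply, LinearMap.id_apply]
  rw [signOp_gen, map_smul, signOp_gen, smul_smul, ← mul_zpow]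
  simp

theorem diffSq_tmul (n : ℕ) (x y : AInf K n) :
    diffSq K n (x ⊗ₜ y) = diff K n x ⊗ₜ y + signOp K n x ⊗ₜ diff K n y := by
  simp [diffSq]

/-- The bilinear map `(a, b) ↦ [a ⊗ b]` on cycles. -/
def cycleTensor (n : ℕ) :
    LinearMap.ker (diff K n) →ₗ[K] LinearMap.ker (diff K n) →ₗ[K] HSq K n :=
  LinearMap.mk₂ K
    (fun a b => Homology.mk (V := AInfSq K n) (diffSq K n) ⟨a.1 ⊗ₜ[K] b.1, by
      rw [LinearMap.mem_ker, diffSq_tmul, LinearMap.mem_ker.1 a.2, LinearMap.mem_ker.1 b.2]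
      simp⟩)
    (fun a a' b => by
      rw [← map_add]; congr 1; ext1; exact TensorProduct.add_tmul _ _ _)
    (fun c a b => by
      rw [← map_smul]; congr 1)
    (fun a b b' => by
      rw [← map_add]; congr 1; ext1; exact TensorProduct.tmul_add _ _ _)
    (fun c a b => by
      rw [← map_smul]; congr 1; ext1; exact TensorProduct.tmul_smul _ _ _)

theorem cycleTensor_right (n : ℕ) (a b : LinearMap.ker (diff K n))
    (hb : b ∈ (LinearMap.range (diff K n)).submoduleOf (LinearMap.ker (diff K n))) :
    cycleTensor n a b = 0 := by
  obtain ⟨y, hy⟩ := hb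
  refine (Submodule.Quotient.mk_eq_zero _).2 ⟨signOp K n a.1 ⊗ₜ[K] y, ?_⟩
  rw [diffSq_tmul, diff_signOp, LinearMap.mem_ker.1 a.2, signOp_signOp, hy]
  simp

theorem cycleTensor_left (n : ℕ) (a b : LinearMap.ker (diff K n))
    (ha : a ∈ (LinearMap.range (diff K n)).submoduleOf (LinearMap.ker (diff K n))) :
    cycleTensor n a b = 0 := by
  obtain ⟨y, hy⟩ := ha
  refine (Submodule.Quotient.mk_eq_zero _).2 ⟨y ⊗ₜ[K] b.1, ?_⟩
  rw [diffSq_tmul, LinearMap.mem_ker.1 b.2, hy]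
  simp

variable (K)

/-- The canonical isomorphism `H_*(A∞(n)) ⊗ H_*(A∞(n)) → H_*((A∞ ⊗ A∞)(n))`,
`[a] ⊗ [b] ↦ [a ⊗ b]`. -/
def kunneth (n : ℕ) :
    HAInf K n ⊗[K] HAInf K n →ₗ[K] HSq K n :=
  TensorProduct.lift <|
    Submodule.liftQ _
      (LinearMap.flip (Submodule.liftQ _ (LinearMap.flip (cycleTensor n)) (by
        intro b hb
        ext a
        exact cycleTensor_right n a b hb)))
      (by
        intro a ha
        rw [LinearMap.mem_ker]
        ext b
        exact cycleTensor_left n a b ha)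

theorem kunneth_mk (n : ℕ) (a b : LinearMap.ker (diff K n)) :
    kunneth K n (Homology.mk _ a ⊗ₜ Homology.mk _ b) =
      Homology.mk (V := AInfSq K n) (diffSq K n) ⟨a.1 ⊗ₜ[K] b.1, by
        rw [LinearMap.mem_ker, diffSq_tmul, LinearMap.mem_ker.1 a.2, LinearMap.mem_ker.1 b.2]
        simp⟩ := rfl

/-! ### The associative operad and `H_*(A∞)` -/

/-- The (non-unital, non-symmetric) associative operad: `As(n) = K μ_n` for `n ≥ 2`, in degree `0`,
where `μ_n` is the `n`-fold product; `μ_m ∘_i μ_n = μ_(m + n - 1)`. -/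
abbrev As (_n : ℕ) : Type _ := K

/-- The canonical diagonal `As → As ⊗ As`, `μ_n ↦ μ_n ⊗ μ_n`. -/
def asDiagonal (n : ℕ) : As K n →ₗ[K] As K n ⊗[K] As K n :=
  LinearMap.toSpanSingleton K _ ((1 : K) ⊗ₜ[K] (1 : K))

/-- The iterated product `(⋯(c_2 ∘_1 c_2) ∘_1 ⋯) ∘_1 c_2` in `A∞(n)`, `n ≥ 2`. -/
def iteratedProduct : (n : ℕ) → AInf K n
  | 0 => 0
  | 1 => 0
  | 2 => corolla K 2
  | n + 3 => circ K (n + 2) 2 1 (iteratedProduct (n + 2)) (corolla K 2)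

theorem circ_gen (m n i : ℕ) (U : PlanarTree m) (V : PlanarTree n) :
    circ K m n i (gen U) (gen V) = (-1 : K) ^ ((i : ℤ) * (n + 1) + m * V.deg) •
      oriented K (m + n - 1)
        (U.edgeList.map (Edge.outer i n) ++ V.edgeList.map (Edge.inner i) ++
          [⟨i, i + n - 1⟩]) := by
  rw [circ, gen, gen, Module.Basis.constr_basis, Module.Basis.constr_basis]

/-- The span of the left combs: the trees with the edges `{1, …, b}`, `2 ≤ b < n`. -/
def combSpan (n : ℕ) : Submodule K (AInf K n) :=
  Submodule.span K {x | ∃ T : PlanarTree n,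
    (∀ b, 2 ≤ b → b < n → (⟨1, b⟩ : Edge) ∈ T.1) ∧ x = gen T}

theorem iteratedProduct_mem (n : ℕ) : iteratedProduct K n ∈ combSpan K n := by
  match n with
  | 0 => exact Submodule.zero_mem _
  | 1 => exact Submodule.zero_mem _
  | 2 =>
    rw [iteratedProduct, corolla, oriented]
    split_ifs
    · exact Submodule.smul_mem _ _ (Submodule.subset_span ⟨_, by intros; omega, rfl⟩)
    · exact Submodule.zero_mem _
  | n + 3 =>
    have ih := iteratedProduct_mem (n + 2)
    rw [iteratedProduct]
    suffices h : ∀ y : AInf K 2, ∀ x ∈ combSpan K (n + 2),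
        circ K (n + 2) 2 1 x y ∈ combSpan K (n + 3) from h _ _ ih
    intro y x hx
    induction hx using Submodule.span_induction with
    | zero => rw [map_zero]; exact Submodule.zero_mem _
    | add x x' _ _ hx hx' => rw [map_add]; exact Submodule.add_mem _ hx hx'
    | smul c x _ hx => rw [map_smul]; exact Submodule.smul_mem _ _ hx
    | mem x h =>
      obtain ⟨U, hU, rfl⟩ := h
      have hy : y ∈ Submodule.span K (Set.range (treeBasis K 2)) := by
        rw [Module.Basis.span_eq]; trivial
      induction hy using Submodule.span_induction with
      | zero => rw [map_zero]; exact Submodule.zero_mem _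
      | add x x' _ _ hx hx' => rw [map_add]; exact Submodule.add_mem _ hx hx'
      | smul c x _ hx => rw [map_smul]; exact Submodule.smul_mem _ _ hx
      | mem x h =>
        obtain ⟨V, rfl⟩ := h
        change circ K (n + 2) 2 1 (gen U) (gen V) ∈ _
        rw [circ_gen]
        refine Submodule.smul_mem _ _ ?_
        rw [oriented]
        split_ifs
        · refine Submodule.smul_mem _ _ (Submodule.subset_span ⟨_, ?_, rfl⟩)
          intro b hb hbn
          rw [List.mem_toFinset]
          rcases Nat.eq_or_lt_of_le hb with rfl | hb'
          · simp
          · simp only [List.mem_append, List.mem_map]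
            refine Or.inl (Or.inl ⟨⟨1, b - 1⟩, ?_, ?_⟩)
            · rw [PlanarTree.edgeList, Finset.mem_sort]
              exact hU _ (by omega) (by omega)
            · ext
              · simp [Edge.outer]
              · simp only [Edge.outer]
                split_ifs <;> omega
        · exact Submodule.zero_mem _

theorem diff_iteratedProduct (n : ℕ) : diff K n (iteratedProduct K n) = 0 := by
  suffices h : ∀ x ∈ combSpan K n, diff K n x = 0 from h _ (iteratedProduct_mem K n)
  intro x hx
  induction hx using Submodule.span_induction with
  | zero => rw [map_zero]
  | add x x' _ _ hx hx' => rw [map_add, hx, hx', add_zero]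
  | smul c x _ hx => rw [map_smul, hx, smul_zero]
  | mem x h =>
    obtain ⟨T, hT, rfl⟩ := h
    rw [diff_gen]
    refine Finset.sum_eq_zero fun a _ => Finset.sum_eq_zero fun b _ => ?_
    rw [oriented, dif_neg]
    rintro ⟨hnd, -, hint, hcomp⟩
    have h1 : 1 ≤ a ∧ a < b ∧ b ≤ n ∧ ¬(a = 1 ∧ b = n) := hint ⟨a, b⟩ (by simp)
    have hmem : ∀ c, 2 ≤ c → c < n → (⟨1, c⟩ : Edge) ∈ T.edgeList := by
      intro c hc hcn
      rw [PlanarTree.edgeList, Finset.mem_sort]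
      exact hT c hc hcn
    rcases Nat.eq_or_lt_of_le h1.1 with rfl | ha
    · exact (List.nodup_cons.1 hnd).1 (hmem b (by omega) (by omega))
    · have h2 := hcomp ⟨a, b⟩ (by simp) ⟨1, a⟩ (by
        rw [List.mem_toFinset]
        exact List.mem_cons_of_mem _ (hmem a (by omega) (by omega)))
      simp only [Edge.Compatible] at h2
      omega

/-- The canonical isomorphism of operads `As → H_*(A∞)`, sending `μ_2` to the class of `c_2`. As
`μ_n` is the iterated product of copies of `μ_2`, it sends `μ_n` to the class of the iterated
product of copies of `c_2`. -/
def asToHomology (n : ℕ) : As K n →ₗ[K] HAInf K n :=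
  LinearMap.toSpanSingleton K _
    (Homology.mk (diff K n) ⟨iteratedProduct K n, diff_iteratedProduct K n⟩)

/-! ### Cyclic diagonals -/

variable {K}

/-- `Δ` is a morphism of dg operads `A∞ → A∞ ⊗ A∞`: it has degree `0` and commutes with the
differentials and with all the compositions `∘_i`. -/
structure IsOperadMorphism (Δ : ∀ n, AInf K n →ₗ[K] AInf K n ⊗[K] AInf K n) : Prop where
  degree : ∀ n k, ∀ x ∈ piece K n k, Δ n x ∈ pieceSq K n k
  comm_diff : ∀ n x, Δ n (diff K n x) = diffSq K n (Δ n x)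
  comm_circ : ∀ m n i, 1 ≤ i → i ≤ m → ∀ x y,
    Δ (m + n - 1) (circ K m n i x y) = circSq K m n i (Δ m x) (Δ n y)

/-- A diagonal of `A∞`: a morphism of dg operads `Δ : A∞ → A∞ ⊗ A∞` such that the induced map
`H_*(A∞) → H_*(A∞ ⊗ A∞) ≅ H_*(A∞) ⊗ H_*(A∞)` is the canonical diagonal `As → As ⊗ As` under
the canonical isomorphism `As ≅ H_*(A∞)`. -/
structure IsDiagonal (Δ : ∀ n, AInf K n →ₗ[K] AInf K n ⊗[K] AInf K n) : Prop
    extends IsOperadMorphism Δ where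
  homology : ∀ n, 2 ≤ n →
    Homology.map (W := AInfSq K n) (Δ n) (comm_diff n) ∘ₗ asToHomology K n =
      kunneth K n ∘ₗ TensorProduct.map (asToHomology K n) (asToHomology K n) ∘ₗ asDiagonal K n

/-- A cyclic diagonal of `A∞`: a diagonal which commutes with the actions of the cyclic groups,
`Δ ∘ r = (r ⊗ r) ∘ Δ`. -/
structure IsCyclicDiagonal (Δ : ∀ n, AInf K n →ₗ[K] AInf K n ⊗[K] AInf K n) : Prop
    extends IsDiagonal Δ where
  comm_rot : ∀ n x, Δ n (rot K n x) = rotSq K n (Δ n x)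

end

end AInfinity

/-!
A cyclic diagonal exists because `A∞` is free as a graded operad on the corollas, on which the
rotation acts by signs, and because `A∞ ⊗ A∞` is acyclic in positive degrees.

Freeness is used in the following form. A family `δ n ∈ A∞(n) ⊗ A∞(n)` of degree `n - 2`, thought of
as the values at the corollas, extends to a map `diagonal δ` on all trees, which is compatible with
all compositions (`diagonal_circTo`). It is defined by splitting off the corolla above the first edge
in post-order, and the compatibility follows by induction from the associativity of the compositions
in `A∞` (`circTo_assoc_gen`, `circTo_comm_gen`) and `A∞ ⊗ A∞` (`circSqTo_assoc`, `circSqTo_comm`).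
Since the compositions are compatible with differential and rotation, `diagonal δ` commutes with
these as soon as it does so on the corollas (`diagonal_diff`, `diagonal_rot`).

So `δ n` is chosen by recursion on `n` (`exists_corollaValues`), as a solution of
`∂ (δ n) = diagonal δ (∂ c_n)`, where the right side only involves `δ k` for `k < n`. The right side
is a cycle, and it bounds: for `n ≥ 4` its degree is positive, where `A∞ ⊗ A∞` has no homology
(`exists_diffSq_eq`), and for `n = 3` there is an explicit solution. In characteristic `0`, averaging
over the cyclic group makes the solution satisfy `(r ⊗ r) (δ n) = (-1)^n δ n`
(`exists_rotSq_eq`). With `δ 2 = c_2 ⊗ c_2`, the extension sends the iterated products of `c_2`, whose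
classes span the homology, to their squares, which is the condition on homology.

The acyclicity comes from a matching of trees. Let the spine of a tree be the set of its edges that
end in the last leaf. Except for the right comb, a spine leaves a gap, and there is an edge filling a
gap that is compatible with all trees having this spine. Removing this edge is a contracting homotopy
for the part of the differential that preserves the spine. The rest of the differential lengthens the
spine, so in positive degrees the identity is homotopic to a nilpotent map
(`spineShift_pow_eq_zero`).

Signs are handled by lists: an orientation of a tree is an ordering of its edges, and each operation
is given by a formula that is alternating in the ordering (`IsAlternating`), so that the formula
holds for all orderings if it holds for the reference ordering (`constr_oriented`).
-/

namespace AInfinity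

noncomputable section

variable {K : Type*} [Field K]

/-! ### Alternating functions of lists of edges -/

/-- A function of lists of edges is alternating if it changes sign when two neighbouring entries
are exchanged. Every pair `(T, e₁ ∧ ⋯ ∧ eₖ)` is alternating in the list `e₁, …, eₖ`, and so are all
the operations on `A∞`. -/
def IsAlternating {W : Type*} [AddCommGroup W] (G : List Edge → W) : Prop :=
  ∀ l₁ a b l₂, G (l₁ ++ a :: b :: l₂) = -G (l₁ ++ b :: a :: l₂)

section Alternating

variable {W : Type*} [AddCommGroup W] [Module K W] {G : List Edge → W}

theorem IsAlternating.append_left (hG : IsAlternating G) (c : List Edge) :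
    IsAlternating fun l => G (c ++ l) := by
  intro l₁ a b l₂
  simpa [List.append_assoc] using hG (c ++ l₁) a b l₂

theorem IsAlternating.map (hG : IsAlternating G) (φ : Edge → Edge) :
    IsAlternating fun l => G (l.map φ) := by
  intro l₁ a b l₂
  simpa using hG (l₁.map φ) (φ a) (φ b) (l₂.map φ)

theorem IsAlternating.smul_length (hG : IsAlternating G) (s : ℕ → K) :
    IsAlternating fun l => s l.length • G l := by
  intro l₁ a b l₂
  simp [hG l₁ a b l₂]

theorem IsAlternating.move (hG : IsAlternating G) (e : Edge) (l₁ l₂ l₃ : List Edge) :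
    G (l₁ ++ e :: (l₂ ++ l₃)) = (-1 : K) ^ l₂.length • G (l₁ ++ l₂ ++ e :: l₃) := by
  induction l₂ generalizing l₁ with
  | nil => simp
  | cons f l₂ ih =>
    have h := ih (l₁ ++ [f])
    simp only [List.append_assoc, List.cons_append, List.nil_append] at h ⊢
    rw [hG, h, List.length_cons, pow_succ, mul_neg_one, neg_smul]

/-- Exchanging two neighbouring blocks. -/
theorem IsAlternating.block (hG : IsAlternating G) (l₁ l₂ l₃ l₄ : List Edge) :
    G (l₁ ++ l₂ ++ l₃ ++ l₄) = (-1 : K) ^ (l₂.length * l₃.length) • G (l₁ ++ l₃ ++ l₂ ++ l₄) := by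
  induction l₂ generalizing l₁ with
  | nil => simp
  | cons f l₂ ih =>
    have h := ih (l₁ ++ [f])
    have h' := hG.move (K := K) f l₁ l₃ (l₂ ++ l₄)
    simp only [List.append_assoc, List.cons_append, List.nil_append] at h h' ⊢
    rw [h, h', List.length_cons, smul_smul, ← pow_add]
    congr 2
    ring

theorem IsAlternating.orderedInsert (hG : IsAlternating G) (e : Edge) (m : List Edge)
    (hm : m.Pairwise (· ≤ ·)) :
    G (e :: m) = (-1 : K) ^ (m.countP fun f => decide (f < e)) •
      G (m.orderedInsert (· ≤ ·) e) := by
  induction m generalizing G with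
  | nil => simp
  | cons f m ih =>
    rw [List.pairwise_cons] at hm
    by_cases h : e ≤ f
    · have h0 : (f :: m).countP (fun f => decide (f < e)) = 0 := by
        rw [List.countP_eq_zero]
        intro g hg
        rcases List.mem_cons.1 hg with rfl | hg
        · simpa using h
        · simpa using h.trans (hm.1 g hg)
      rw [h0, List.orderedInsert_cons_of_le _ _ h]
      simp
    · rw [List.orderedInsert_of_not_le _ _ h]
      have h1 := ih (hG.append_left [f]) hm.2
      have h2 := hG [] e f m
      simp only [List.nil_append, List.cons_append] at h1 h2
      rw [h2, h1, List.countP_cons_of_pos (by simpa using h), pow_succ, mul_neg_one, neg_smul]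

theorem IsAlternating.insertionSort (hG : IsAlternating G) (l : List Edge) :
    G l = orderSign K l • G (l.insertionSort (· ≤ ·)) := by
  induction l generalizing G with
  | nil => simp [orderSign]
  | cons e l ih =>
    have h1 := ih (hG.append_left [e])
    simp only [List.cons_append, List.nil_append] at h1
    rw [h1, hG.orderedInsert (K := K) e _ (List.pairwise_insertionSort _ _), smul_smul, orderSign,
      (List.perm_insertionSort (· ≤ ·) l).countP_eq, mul_comm]
    rfl

theorem IsAlternating.sort (hG : IsAlternating G) {l : List Edge} (hl : l.Nodup) :
    G l = orderSign K l • G (l.toFinset.sort (· ≤ ·)) := by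
  rw [hG.insertionSort (K := K) l]
  congr 2
  have hp := List.perm_insertionSort (· ≤ ·) l
  rw [← List.toFinset_eq_of_perm _ _ hp]
  exact ((List.toFinset_sort (· ≤ ·) (hp.nodup_iff.2 hl)).2 (List.pairwise_insertionSort _ _)).symm

end Alternating

theorem orderSign_mul_self (l : List Edge) : orderSign K l * orderSign K l = 1 := by
  induction l with
  | nil => simp [orderSign]
  | cons e l ih =>
    rw [orderSign, mul_mul_mul_comm, ih, mul_one, ← pow_add, ← two_mul, pow_mul]
    simp

theorem orderSign_swap {a b : Edge} (hab : a ≠ b) (l : List Edge) :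
    orderSign K (a :: b :: l) = -orderSign K (b :: a :: l) := by
  simp only [orderSign, List.countP_cons]
  rcases lt_or_gt_of_ne hab with h | h
  · simp [h, not_lt_of_gt h, pow_succ]
    ring
  · simp [h, not_lt_of_gt h, pow_succ]
    ring

theorem orderSign_append_swap {a b : Edge} (hab : a ≠ b) (l₁ l₂ : List Edge) :
    orderSign K (l₁ ++ a :: b :: l₂) = -orderSign K (l₁ ++ b :: a :: l₂) := by
  induction l₁ with
  | nil => exact orderSign_swap hab l₂
  | cons e l ih =>
    have : (l ++ a :: b :: l₂).Perm (l ++ b :: a :: l₂) := (List.Perm.swap b a l₂).append_left l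
    rw [List.cons_append, List.cons_append, orderSign, orderSign, ih, this.countP_eq, mul_neg]

/-- The planar tree with a given set of internal edges. -/
def PlanarTree.ofFinset {n : ℕ} (s : Finset Edge) (h : IsTree n s) : PlanarTree n := ⟨s, h⟩

theorem oriented_of_tree {n : ℕ} {l : List Edge} (h : l.Nodup) (h' : IsTree n l.toFinset) :
    oriented K n l = orderSign K l • gen (PlanarTree.ofFinset l.toFinset h') := dif_pos ⟨h, h'⟩

theorem oriented_eq_zero {n : ℕ} {l : List Edge} (h : ¬(l.Nodup ∧ IsTree n l.toFinset)) :
    oriented K n l = 0 := dif_neg h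

theorem oriented_alternating (n : ℕ) : IsAlternating (oriented K n) := by
  intro l₁ a b l₂
  have hp : (l₁ ++ a :: b :: l₂).Perm (l₁ ++ b :: a :: l₂) := (List.Perm.swap b a l₂).append_left l₁
  have hs := List.toFinset_eq_of_perm _ _ hp
  by_cases h : (l₁ ++ a :: b :: l₂).Nodup ∧ IsTree n (l₁ ++ a :: b :: l₂).toFinset
  · have hab : a ≠ b := by
      rintro rfl
      have := (List.nodup_append.1 h.1).2.1
      simp at this
    have h2 : IsTree n (l₁ ++ b :: a :: l₂).toFinset := hs ▸ h.2
    rw [oriented_of_tree h.1 h.2, oriented_of_tree (hp.nodup_iff.1 h.1) h2,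
      orderSign_append_swap hab, neg_smul]
    congr 3
    exact Subtype.ext hs
  · rw [oriented_eq_zero h, oriented_eq_zero (by rwa [← hs, ← hp.nodup_iff]), neg_zero]

theorem PlanarTree.nodup_edgeList {n : ℕ} (T : PlanarTree n) : T.edgeList.Nodup :=
  Finset.sort_nodup _ _

theorem PlanarTree.toFinset_edgeList {n : ℕ} (T : PlanarTree n) : T.edgeList.toFinset = T.1 :=
  Finset.sort_toFinset _ _

theorem PlanarTree.mem_edgeList {n : ℕ} {T : PlanarTree n} {e : Edge} :
    e ∈ T.edgeList ↔ e ∈ T.1 := Finset.mem_sort _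

theorem PlanarTree.isTree_edgeList {n : ℕ} (T : PlanarTree n) : IsTree n T.edgeList.toFinset := by
  rw [T.toFinset_edgeList]; exact T.2

/-- A linear map that is given on trees by an alternating function of their edges is given by the
same formula for every ordering of the edges. -/
theorem constr_oriented {W : Type*} [AddCommGroup W] [Module K W] {n : ℕ} {G : List Edge → W}
    (hG : IsAlternating G) {l : List Edge} (hl : l.Nodup) (ht : IsTree n l.toFinset) :
    (treeBasis K n).constr K (fun T => G T.edgeList) (oriented K n l) = G l := by
  rw [oriented_of_tree hl ht, map_smul, ← treeBasis_apply, Module.Basis.constr_basis,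
    hG.sort (K := K) hl]
  rfl

theorem constr_oriented' {W : Type*} [AddCommGroup W] [Module K W] {n : ℕ} {G : List Edge → W}
    (hG : IsAlternating G) (h0 : ∀ l, ¬(l.Nodup ∧ IsTree n l.toFinset) → G l = 0) (l : List Edge) :
    (treeBasis K n).constr K (fun T => G T.edgeList) (oriented K n l) = G l := by
  by_cases h : l.Nodup ∧ IsTree n l.toFinset
  · exact constr_oriented hG h.1 h.2
  · rw [oriented_eq_zero h, map_zero, h0 l h]

theorem gen_eq_oriented {n : ℕ} (T : PlanarTree n) : (gen T : AInf K n) =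
    oriented K n T.edgeList := by
  have h := constr_oriented (K := K) (oriented_alternating (K := K) n) T.nodup_edgeList T.isTree_edgeList
  have h' : (treeBasis K n).constr K (fun T => oriented K n T.edgeList) (gen T) =
      oriented K n T.edgeList := by
    rw [← treeBasis_apply, Module.Basis.constr_basis]
  have h1 : oriented K n T.edgeList = orderSign K T.edgeList • gen T := by
    rw [oriented_of_tree T.nodup_edgeList T.isTree_edgeList]
    congr 2
    exact Subtype.ext T.toFinset_edgeList
  have h2 : orderSign K T.edgeList = 1 := by
    have hs : ∀ l : List Edge, l.Pairwise (· ≤ ·) → orderSign K l = 1 := by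
      intro l hl
      induction l with
      | nil => rfl
      | cons e l ih =>
        rw [List.pairwise_cons] at hl
        rw [orderSign, ih hl.2, List.countP_eq_zero.2, pow_zero, mul_one]
        intro f hf
        simpa using hl.1 f hf
    exact hs _ (Finset.pairwise_sort _ _)
  rw [h1, h2, one_smul]

theorem gen_eq_smul_oriented {n : ℕ} {T : PlanarTree n} {l : List Edge} (hl : l.Nodup)
    (h : l.toFinset = T.1) : (gen T : AInf K n) = orderSign K l • oriented K n l := by
  have h' : IsTree n l.toFinset := h ▸ T.2
  rw [oriented_of_tree hl h', smul_smul, orderSign_mul_self, one_smul]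
  congr 1
  exact Subtype.ext h.symm

theorem AInf_hom_ext {n : ℕ} {W : Type*} [AddCommGroup W] [Module K W] {f g : AInf K n →ₗ[K] W}
    (h : ∀ T, f (gen T) = g (gen T)) : f = g :=
  (treeBasis K n).ext fun T => h T

theorem gen_mem_piece {n : ℕ} (T : PlanarTree n) : (gen T : AInf K n) ∈ piece K n T.deg :=
  Submodule.subset_span ⟨T, rfl, rfl⟩

theorem oriented_append_comm (n : ℕ) (l₁ l₂ l₃ l₄ : List Edge) :
    oriented K n (l₁ ++ l₂ ++ l₃ ++ l₄) =
      (-1 : K) ^ ((l₂.length : ℤ) * l₃.length) • oriented K n (l₁ ++ l₃ ++ l₂ ++ l₄) := by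
  rw [(oriented_alternating n).block (K := K)]
  norm_cast

theorem neg_one_zpow_congr {a b : ℤ} (h : (a : ZMod 2) = b) : (-1 : K) ^ a = (-1) ^ b := by
  have h' : Even (a - b) := by
    rw [← ZMod.intCast_eq_zero_iff_even, Int.cast_sub, h, sub_self]
  rw [← sub_add_cancel a b, zpow_add₀ (by simp), h'.neg_one_zpow, one_mul]

theorem neg_one_zpow_add (a b : ℤ) : (-1 : K) ^ a * (-1) ^ b = (-1) ^ (a + b) :=
  (zpow_add₀ (by simp) a b).symm

end

/-! ### Lists of edges of trees -/

/-- Distinct edges that can occur in the same tree. -/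
def Edge.Indep (e f : Edge) : Prop := e ≠ f ∧ e.Compatible f

theorem Edge.Compatible.symm {e f : Edge} (h : e.Compatible f) : f.Compatible e := by
  unfold Edge.Compatible at *
  omega

theorem Edge.Indep.symm {e f : Edge} (h : e.Indep f) : f.Indep e := ⟨h.1.symm, h.2.symm⟩

theorem Edge.Compatible.refl (e : Edge) : e.Compatible e := Or.inl ⟨le_rfl, le_rfl⟩

/-- The entries of `l` are the internal edges of a tree with `n` leaves, without repetition. -/
def IsTreeList (n : ℕ) (l : List Edge) : Prop := l.Nodup ∧ IsTree n l.toFinset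

theorem isTreeList_iff {n : ℕ} {l : List Edge} :
    IsTreeList n l ↔ 2 ≤ n ∧ (∀ e ∈ l, e.IsInternal n) ∧ l.Pairwise Edge.Indep := by
  simp only [IsTreeList, IsTree, List.mem_toFinset]
  constructor
  · rintro ⟨h, h2, h3, h4⟩
    refine ⟨h2, h3, ?_⟩
    exact List.Pairwise.imp_of_mem (fun {a b} ha hb hab => ⟨hab, h4 a ha b hb⟩) h
  · rintro ⟨h2, h3, h4⟩
    refine ⟨h4.imp fun h => h.1, h2, h3, ?_⟩
    have h5 : l.Pairwise Edge.Compatible := h4.imp fun h => h.2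
    intro e he f hf
    rcases eq_or_ne e f with rfl | hne
    · exact Edge.Compatible.refl e
    · have : Std.Symm Edge.Compatible := ⟨fun _ _ h => h.symm⟩
      exact h5.forall he hf hne

theorem IsTreeList.internal {n : ℕ} {l : List Edge} (h : IsTreeList n l) {e : Edge} (he : e ∈ l) :
    e.IsInternal n := (isTreeList_iff.1 h).2.1 e he

theorem IsTreeList.two_le {n : ℕ} {l : List Edge} (h : IsTreeList n l) : 2 ≤ n := h.2.1

theorem IsTreeList.perm {n : ℕ} {l l' : List Edge} (h : IsTreeList n l) (hp : l.Perm l') :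
    IsTreeList n l' :=
  ⟨hp.nodup_iff.1 h.1, List.toFinset_eq_of_perm _ _ hp ▸ h.2⟩

theorem IsTreeList.of_cons {n : ℕ} {e : Edge} {l : List Edge} (h : IsTreeList n (e :: l)) :
    IsTreeList n l := by
  rw [isTreeList_iff] at h ⊢
  exact ⟨h.1, fun f hf => h.2.1 f (List.mem_cons_of_mem _ hf), (List.pairwise_cons.1 h.2.2).2⟩

theorem isTreeList_cons {n : ℕ} {e : Edge} {l : List Edge} :
    IsTreeList n (e :: l) ↔ e.IsInternal n ∧ (∀ f ∈ l, e.Indep f) ∧ IsTreeList n l := by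
  simp only [isTreeList_iff, List.pairwise_cons, List.forall_mem_cons]
  tauto

theorem PlanarTree.isTreeList {n : ℕ} (T : PlanarTree n) : IsTreeList n T.edgeList :=
  ⟨T.nodup_edgeList, T.isTree_edgeList⟩

theorem PlanarTree.two_le {n : ℕ} (T : PlanarTree n) : 2 ≤ n := T.2.1

/-! ### Edges under grafting and rotation -/

section Edges

variable {m n i N : ℕ} {e e' : Edge}

theorem Edge.outer_internal (hN : N = m + n - 1) (hn : 2 ≤ n) (hi : 1 ≤ i)
    (he : e.IsInternal m) : (e.outer i n).IsInternal N := by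
  obtain ⟨a, b⟩ := e
  simp only [Edge.outer, Edge.IsInternal] at *
  split_ifs <;> omega

theorem Edge.inner_internal (hN : N = m + n - 1) (hi : 1 ≤ i) (him : i ≤ m)
    (he : e.IsInternal n) : (e.inner i).IsInternal N := by
  obtain ⟨a, b⟩ := e
  simp only [Edge.inner, Edge.IsInternal] at *
  omega

theorem Edge.graft_internal_iff (hN : N = m + n - 1) (hi : 1 ≤ i) (him : i ≤ m) :
    (⟨i, i + n - 1⟩ : Edge).IsInternal N ↔ 2 ≤ m ∧ 2 ≤ n := by
  simp only [Edge.IsInternal]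
  omega

theorem Edge.outer_indep_iff (hn : 2 ≤ n) (he : e.IsInternal m) (he' : e'.IsInternal m) :
    (e.outer i n).Indep (e'.outer i n) ↔ e.Indep e' := by
  obtain ⟨a, b⟩ := e
  obtain ⟨a', b'⟩ := e'
  simp only [Edge.outer, Edge.IsInternal, Edge.Indep, Edge.Compatible, ne_eq, Edge.mk.injEq] at *
  split_ifs <;> omega

theorem Edge.inner_indep_iff (hi : 1 ≤ i) :
    (e.inner i).Indep (e'.inner i) ↔ e.Indep e' := by
  obtain ⟨a, b⟩ := e
  obtain ⟨a', b'⟩ := e'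
  simp only [Edge.inner, Edge.Indep, Edge.Compatible, ne_eq, Edge.mk.injEq] at *
  omega

theorem Edge.outer_indep_inner (he : e.IsInternal m) (he' : e'.IsInternal n) :
    (e.outer i n).Indep (e'.inner i) := by
  obtain ⟨a, b⟩ := e
  obtain ⟨a', b'⟩ := e'
  simp only [Edge.outer, Edge.inner, Edge.IsInternal, Edge.Indep, Edge.Compatible, ne_eq,
    Edge.mk.injEq] at *
  split_ifs <;> omega

theorem Edge.outer_indep_graft (hn : 2 ≤ n) (he : e.IsInternal m) :
    (e.outer i n).Indep ⟨i, i + n - 1⟩ := by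
  obtain ⟨a, b⟩ := e
  simp only [Edge.outer, Edge.IsInternal, Edge.Indep, Edge.Compatible, ne_eq, Edge.mk.injEq] at *
  split_ifs <;> omega

theorem Edge.inner_indep_graft (he : e.IsInternal n) :
    (e.inner i).Indep ⟨i, i + n - 1⟩ := by
  obtain ⟨a, b⟩ := e
  simp only [Edge.inner, Edge.IsInternal, Edge.Indep, Edge.Compatible, ne_eq, Edge.mk.injEq] at *
  omega

/-- Left inverse of `Edge.outer`: the leaves `i, …, i + n - 1` are merged into the leaf `i`. -/
def Edge.collapse (i n : ℕ) (e : Edge) : Edge :=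
  ⟨if e.first ≤ i then e.first else e.first + 1 - n,
    if e.last < i then e.last else e.last + 1 - n⟩

theorem Edge.collapse_outer (hn : 1 ≤ n) : (e.outer i n).collapse i n = e := by
  obtain ⟨a, b⟩ := e
  simp only [Edge.outer, Edge.collapse, Edge.mk.injEq]
  split_ifs <;> omega

/-- An edge that is independent of the grafting edge and not above it comes from the lower tree. -/
theorem Edge.outer_collapse (hN : N = m + n - 1) (hn : 2 ≤ n) (hi : 1 ≤ i) (him : i ≤ m)
    (he : e.IsInternal N) (hg : e.Indep ⟨i, i + n - 1⟩) (h : ¬(i ≤ e.first ∧ e.last ≤ i + n - 1)) :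
    (e.collapse i n).outer i n = e ∧ (e.collapse i n).IsInternal m := by
  obtain ⟨a, b⟩ := e
  simp only [Edge.outer, Edge.collapse, Edge.IsInternal, Edge.Indep, Edge.Compatible, ne_eq,
    Edge.mk.injEq] at *
  split_ifs <;> omega

theorem Edge.exists_inner (hi : 1 ≤ i) (he : e.IsInternal N) (hg : e.Indep ⟨i, i + n - 1⟩)
    (h : i ≤ e.first ∧ e.last ≤ i + n - 1) : ∃ e' : Edge, e'.inner i = e ∧ e'.IsInternal n := by
  obtain ⟨a, b⟩ := e
  refine ⟨⟨a + 1 - i, b + 1 - i⟩, ?_⟩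
  simp only [Edge.inner, Edge.IsInternal, Edge.Indep, Edge.Compatible, ne_eq,
    Edge.mk.injEq] at *
  omega

theorem Edge.outer_injective (hn : 1 ≤ n) : Function.Injective (Edge.outer i n) :=
  Function.LeftInverse.injective (g := Edge.collapse i n) fun _ => Edge.collapse_outer hn

theorem Edge.inner_injective (hi : 1 ≤ i) : Function.Injective (Edge.inner i) := by
  rintro ⟨a, b⟩ ⟨a', b'⟩ h
  simp only [Edge.inner, Edge.mk.injEq] at *
  omega

theorem isTreeList_graft_iff (hN : N = m + n - 1) (hi : 1 ≤ i) (him : i ≤ m) {l l' : List Edge}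
    (hl : ∀ e ∈ l, e.IsInternal m) (hl' : ∀ e ∈ l', e.IsInternal n) :
    IsTreeList N (l.map (Edge.outer i n) ++ l'.map (Edge.inner i) ++ [⟨i, i + n - 1⟩]) ↔
      IsTreeList m l ∧ IsTreeList n l' := by
  simp only [isTreeList_iff, List.pairwise_append, List.pairwise_map, List.mem_append,
    List.mem_map, List.mem_singleton, forall_eq, List.pairwise_singleton]
  constructor
  · rintro ⟨-, h, ⟨h1, h2, -⟩, -⟩
    obtain ⟨hm, hn⟩ := (Edge.graft_internal_iff hN hi him).1 (h _ (Or.inr rfl))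
    refine ⟨⟨hm, hl, ?_⟩, hn, hl', ?_⟩
    · exact h1.imp_of_mem fun ha hb h => (Edge.outer_indep_iff hn (hl _ ha) (hl _ hb)).1 h
    · exact h2.imp fun h => (Edge.inner_indep_iff hi).1 h
  · rintro ⟨⟨hm, -, h1⟩, hn, -, h2⟩
    refine ⟨by omega, ?_, ⟨?_, ?_, ?_⟩, trivial, ?_⟩
    · rintro _ ((⟨e, he, rfl⟩ | ⟨e, he, rfl⟩) | rfl)
      · exact Edge.outer_internal hN hn hi (hl e he)
      · exact Edge.inner_internal hN hi him (hl' e he)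
      · exact (Edge.graft_internal_iff hN hi him).2 ⟨hm, hn⟩
    · exact h1.imp_of_mem fun ha hb h => (Edge.outer_indep_iff hn (hl _ ha) (hl _ hb)).2 h
    · exact h2.imp fun h => (Edge.inner_indep_iff hi).2 h
    · rintro _ ⟨e, he, rfl⟩ _ ⟨e', he', rfl⟩
      exact Edge.outer_indep_inner (hl e he) (hl' e' he')
    · rintro _ (⟨e, he, rfl⟩ | ⟨e, he, rfl⟩)
      · exact Edge.outer_indep_graft hn (hl e he)
      · exact Edge.inner_indep_graft (hl' e he)

theorem Edge.rotate_internal (he : e.IsInternal n) : (e.rotate n).IsInternal n := by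
  obtain ⟨a, b⟩ := e
  simp only [Edge.rotate, Edge.IsInternal] at *
  split_ifs <;> simp only <;> omega

theorem Edge.rotate_indep_iff (he : e.IsInternal n) (he' : e'.IsInternal n) :
    (e.rotate n).Indep (e'.rotate n) ↔ e.Indep e' := by
  obtain ⟨a, b⟩ := e
  obtain ⟨a', b'⟩ := e'
  simp only [Edge.IsInternal] at he he'
  by_cases hb : b = n <;> by_cases hb' : b' = n <;>
    simp only [Edge.rotate, if_true, if_false, hb, hb', Edge.Indep, Edge.Compatible, ne_eq,
      true_and, and_true, and_false, not_false_eq_true,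
      Edge.mk.injEq] <;> omega

theorem isTreeList_rotate_iff {l : List Edge} (hl : ∀ e ∈ l, e.IsInternal n) :
    IsTreeList n (l.map (Edge.rotate n)) ↔ IsTreeList n l := by
  simp only [isTreeList_iff, List.pairwise_map, List.mem_map]
  refine and_congr_right fun _ => and_congr ⟨fun _ => hl, ?_⟩ ⟨fun h => ?_, fun h => ?_⟩
  · rintro h _ ⟨e, he, rfl⟩
    exact Edge.rotate_internal (h e he)
  · exact h.imp_of_mem fun ha hb h => (Edge.rotate_indep_iff (hl _ ha) (hl _ hb)).1 h
  · exact h.imp_of_mem fun ha hb h => (Edge.rotate_indep_iff (hl _ ha) (hl _ hb)).2 h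

theorem Edge.iterate_rotate_of_le (k : ℕ) (a b : ℕ) (h : b + k ≤ n) :
    (Edge.rotate n)^[k] ⟨a, b⟩ = ⟨a + k, b + k⟩ := by
  induction k with
  | zero => rfl
  | succ k ih =>
    rw [Function.iterate_succ_apply', ih (by omega)]
    have h' : ¬b + k = n := by omega
    simp only [Edge.rotate, h', if_false]
    rfl

theorem Edge.iterate_rotate (he : e.IsInternal n) : (Edge.rotate n)^[n + 1] e = e := by
  obtain ⟨a, b⟩ := e
  simp only [Edge.IsInternal] at he
  have h : n + 1 = (a - 1) + (1 + ((b - a) + (1 + (n - b)))) := by omega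
  rw [h, Function.iterate_add_apply, Function.iterate_add_apply, Function.iterate_add_apply,
    Function.iterate_add_apply, Edge.iterate_rotate_of_le (n - b) a b (by omega)]
  have h1 : ∀ a' b' : ℕ, b' = n → Edge.rotate n ⟨a', b'⟩ = ⟨1, a'⟩ := fun a' b' h => if_pos h
  rw [Function.iterate_one, h1 (a + (n - b)) (b + (n - b)) (by omega),
    Edge.iterate_rotate_of_le (b - a) 1 (a + (n - b)) (by omega),
    h1 (1 + (b - a)) (a + (n - b) + (b - a)) (by omega),
    Edge.iterate_rotate_of_le (a - 1) 1 (1 + (b - a)) (by omega)]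
  simp only [Edge.mk.injEq]
  omega

end Edges

/-- The internal edges that occur in the trees with `n` leaves. -/
def internalEdges (n : ℕ) : Finset Edge :=
  ((Finset.Icc 1 n ×ˢ Finset.Icc 1 n).image fun p => ⟨p.1, p.2⟩).filter fun e =>
    1 ≤ e.first ∧ e.first < e.last ∧ e.last ≤ n ∧ ¬(e.first = 1 ∧ e.last = n)

theorem mem_internalEdges {n : ℕ} {e : Edge} : e ∈ internalEdges n ↔ e.IsInternal n := by
  simp only [internalEdges, Finset.mem_filter, Finset.mem_image, Finset.mem_product,
    Finset.mem_Icc, Prod.exists]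
  refine ⟨fun h => h.2, fun h => ⟨⟨e.first, e.last, ?_, rfl⟩, h⟩⟩
  have := h.1
  have := h.2.1
  have := h.2.2.1
  omega

noncomputable section

variable {K : Type*} [Field K]

/-! ### The operations of `A∞` on arbitrarily ordered trees -/

theorem oriented_of_not {n : ℕ} {l : List Edge} (h : ¬IsTreeList n l) : oriented K n l = 0 :=
  oriented_eq_zero h

theorem diff_oriented (n : ℕ) (l : List Edge) :
    diff K n (oriented K n l) = ∑ e ∈ internalEdges n, oriented K n (e :: l) := by
  have h : diff K n = (treeBasis K n).constr K fun T : PlanarTree n =>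
      (fun l => ∑ e ∈ internalEdges n, oriented K n (e :: l)) T.edgeList := by
    refine AInf_hom_ext fun T => ?_
    rw [diff_gen, ← treeBasis_apply, Module.Basis.constr_basis, ← Finset.sum_product']
    dsimp only
    rw [internalEdges, Finset.sum_filter_of_ne, Finset.sum_image]
    · rintro ⟨a, b⟩ - ⟨c, d⟩ - h
      simpa using h
    · intro e _ he
      by_contra h
      refine he (oriented_of_not fun h' => h ?_)
      exact h'.internal List.mem_cons_self
  rw [h, constr_oriented' (G := fun l => ∑ e ∈ internalEdges n, oriented K n (e :: l))]
  · intro l₁ a b l₂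
    dsimp only
    rw [← Finset.sum_neg_distrib]
    refine Finset.sum_congr rfl fun e _ => ?_
    exact oriented_alternating n (e :: l₁) a b l₂
  · intro l hl
    exact Finset.sum_eq_zero fun e _ => oriented_of_not fun h => hl h.of_cons

theorem rot_gen {n : ℕ} (T : PlanarTree n) :
    rot K n (gen T) = (-1 : K) ^ n • oriented K n (T.edgeList.map (Edge.rotate n)) := by
  rw [rot, ← treeBasis_apply, Module.Basis.constr_basis]

theorem rot_oriented {n : ℕ} {l : List Edge} (hl : ∀ e ∈ l, e.IsInternal n) :
    rot K n (oriented K n l) = (-1 : K) ^ n • oriented K n (l.map (Edge.rotate n)) := by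
  by_cases h : IsTreeList n l
  · exact constr_oriented (G := fun l => (-1 : K) ^ n • oriented K n (l.map (Edge.rotate n)))
      (((oriented_alternating n).map _).smul_length fun _ => (-1 : K) ^ n) h.1 h.2
  · rw [oriented_of_not h, oriented_of_not (by rwa [isTreeList_rotate_iff hl]), map_zero,
      smul_zero]

variable (K) in
/-- The composition `∘_i : A∞(m) ⊗ A∞(n) → A∞(N)`, to be used with `N = m + n - 1`. Keeping the
arity `N` of the result separate allows for statements between compositions whose arities are equal
without being syntactically the same. -/
def circTo (m n i N : ℕ) : AInf K m →ₗ[K] AInf K n →ₗ[K] AInf K N :=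
  (treeBasis K m).constr K fun U => (treeBasis K n).constr K fun V =>
    (-1 : K) ^ ((i : ℤ) * (n + 1) + m * V.deg) •
      oriented K N
        (U.edgeList.map (Edge.outer i n) ++ V.edgeList.map (Edge.inner i) ++ [⟨i, i + n - 1⟩])

theorem PlanarTree.deg_eq_length {n : ℕ} (T : PlanarTree n) :
    T.deg = (n : ℤ) - 2 - T.edgeList.length := by
  rw [PlanarTree.deg, PlanarTree.edgeList, Finset.length_sort]

theorem circTo_gen (m n i N : ℕ) (U : PlanarTree m) (V : PlanarTree n) :
    circTo K m n i N (gen U) (gen V) = (-1 : K) ^ ((i : ℤ) * (n + 1) + m * V.deg) •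
      oriented K N
        (U.edgeList.map (Edge.outer i n) ++ V.edgeList.map (Edge.inner i) ++ [⟨i, i + n - 1⟩]) := by
  rw [circTo, ← treeBasis_apply, ← treeBasis_apply, Module.Basis.constr_basis,
    Module.Basis.constr_basis]

theorem circTo_gen_oriented (m n i N : ℕ) (U : PlanarTree m) {l : List Edge}
    (hl : IsTreeList n l) :
    circTo K m n i N (gen U) (oriented K n l) =
      (-1 : K) ^ ((i : ℤ) * (n + 1) + m * ((n : ℤ) - 2 - l.length)) •
        oriented K N
          (U.edgeList.map (Edge.outer i n) ++ l.map (Edge.inner i) ++ [⟨i, i + n - 1⟩]) := by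
  have hG : IsAlternating fun l =>
      (-1 : K) ^ ((i : ℤ) * (n + 1) + m * ((n : ℤ) - 2 - (l.length : ℤ))) • oriented K N
        (U.edgeList.map (Edge.outer i n) ++ l.map (Edge.inner i) ++ [⟨i, i + n - 1⟩]) := by
    intro l₁ a b l₂
    have h := oriented_alternating (K := K) N (U.edgeList.map (Edge.outer i n) ++
      l₁.map (Edge.inner i)) (a.inner i) (b.inner i) (l₂.map (Edge.inner i) ++ [⟨i, i + n - 1⟩])
    simp only [List.append_assoc, List.map_append, List.map_cons, List.cons_append,
      List.length_append, List.length_cons] at h ⊢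
    rw [h, smul_neg]
  rw [← constr_oriented (K := K) hG hl.1 hl.2]
  refine LinearMap.congr_fun (AInf_hom_ext fun V => ?_) _
  rw [circTo_gen, ← treeBasis_apply, Module.Basis.constr_basis, V.deg_eq_length]

theorem circTo_oriented {m n i N : ℕ} (hN : N = m + n - 1) (hi : 1 ≤ i) (him : i ≤ m)
    {l l' : List Edge} (hl : ∀ e ∈ l, e.IsInternal m) (hl' : ∀ e ∈ l', e.IsInternal n) :
    circTo K m n i N (oriented K m l) (oriented K n l') =
      (-1 : K) ^ ((i : ℤ) * (n + 1) + m * ((n : ℤ) - 2 - l'.length)) •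
        oriented K N
          (l.map (Edge.outer i n) ++ l'.map (Edge.inner i) ++ [⟨i, i + n - 1⟩]) := by
  by_cases h : IsTreeList m l ∧ IsTreeList n l'
  · have hG : IsAlternating fun l =>
        (-1 : K) ^ ((i : ℤ) * (n + 1) + m * ((n : ℤ) - 2 - (l'.length : ℤ))) • oriented K N
          (l.map (Edge.outer i n) ++ l'.map (Edge.inner i) ++ [⟨i, i + n - 1⟩]) := by
      intro l₁ a b l₂
      have h := oriented_alternating (K := K) N (l₁.map (Edge.outer i n)) (a.outer i n)
        (b.outer i n) (l₂.map (Edge.outer i n) ++ l'.map (Edge.inner i) ++ [⟨i, i + n - 1⟩])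
      simp only [List.append_assoc, List.map_append, List.map_cons, List.cons_append] at h ⊢
      rw [h, smul_neg]
    rw [← constr_oriented (K := K) hG h.1.1 h.1.2]
    refine LinearMap.congr_fun (f := (circTo K m n i N).flip (oriented K n l'))
      (AInf_hom_ext fun U => ?_) _
    rw [LinearMap.flip_apply, circTo_gen_oriented _ _ _ _ _ h.2, ← treeBasis_apply,
      Module.Basis.constr_basis]
  · have h' := h
    rw [← isTreeList_graft_iff hN hi him hl hl'] at h'
    rw [oriented_of_not h', smul_zero]
    rw [not_and_or] at h
    rcases h with h | h
    · rw [oriented_of_not h, map_zero, LinearMap.zero_apply]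
    · rw [oriented_of_not h, map_zero]

/-! ### The operad identities in `A∞` -/

theorem diff_gen_sum {n : ℕ} (T : PlanarTree n) :
    diff K n (gen T) = ∑ e ∈ internalEdges n, oriented K n (e :: T.edgeList) := by
  rw [gen_eq_oriented, diff_oriented]

theorem PlanarTree.internal {n : ℕ} (T : PlanarTree n) {e : Edge} (he : e ∈ T.edgeList) :
    e.IsInternal n := T.isTreeList.internal he

/-- The edges that are independent of a grafting edge come from exactly one of the two trees. -/
theorem sum_internalEdges_graft {m n i N : ℕ} (hN : N = m + n - 1) (hn : 2 ≤ n) (hi : 1 ≤ i)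
    (him : i ≤ m) {W : Type*} [AddCommGroup W] (F : Edge → W)
    (hF : ∀ e, ¬e.Indep ⟨i, i + n - 1⟩ → F e = 0) :
    ∑ e ∈ internalEdges N, F e =
      ∑ e ∈ internalEdges m, F (e.outer i n) + ∑ e ∈ internalEdges n, F (e.inner i) := by
  classical
  rw [← Finset.sum_image (f := F) (g := Edge.outer i n)
      fun _ _ _ _ h => Edge.outer_injective (by omega) h,
    ← Finset.sum_image (f := F) (g := Edge.inner i) fun _ _ _ _ h => Edge.inner_injective hi h,
    ← Finset.sum_union]
  · symm
    refine Finset.sum_subset ?_ ?_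
    · intro e he
      rw [Finset.mem_union, Finset.mem_image, Finset.mem_image] at he
      rw [mem_internalEdges]
      rcases he with ⟨e, he, rfl⟩ | ⟨e, he, rfl⟩
      · exact Edge.outer_internal hN hn hi (mem_internalEdges.1 he)
      · exact Edge.inner_internal hN hi him (mem_internalEdges.1 he)
    · intro e he h
      refine hF e fun hg => h ?_
      rw [mem_internalEdges] at he
      rw [Finset.mem_union, Finset.mem_image, Finset.mem_image]
      by_cases hc : i ≤ e.first ∧ e.last ≤ i + n - 1
      · obtain ⟨e', h1, h2⟩ := Edge.exists_inner hi he hg hc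
        exact Or.inr ⟨e', mem_internalEdges.2 h2, h1⟩
      · obtain ⟨h1, h2⟩ := Edge.outer_collapse hN hn hi him he hg hc
        exact Or.inl ⟨_, mem_internalEdges.2 h2, h1⟩
  · rw [Finset.disjoint_left]
    intro e h1 h2
    rw [Finset.mem_image] at h1 h2
    obtain ⟨e1, h1, rfl⟩ := h1
    obtain ⟨e2, h2, h3⟩ := h2
    exact (Edge.outer_indep_inner (mem_internalEdges.1 h1) (mem_internalEdges.1 h2)).1 h3.symm

theorem diff_circTo_gen {m n i N : ℕ} (hN : N = m + n - 1) (hi : 1 ≤ i) (him : i ≤ m)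
    (U : PlanarTree m) (V : PlanarTree n) :
    diff K N (circTo K m n i N (gen U) (gen V)) =
      circTo K m n i N (diff K m (gen U)) (gen V) +
        (-1 : K) ^ U.deg • circTo K m n i N (gen U) (diff K n (gen V)) := by
  have hU : ∀ e ∈ U.edgeList, e.IsInternal m := fun e he => U.internal he
  have hV : ∀ e ∈ V.edgeList, e.IsInternal n := fun e he => V.internal he
  rw [circTo_gen, map_smul, diff_oriented, sum_internalEdges_graft hN V.two_le hi him, smul_add,
    diff_gen_sum, diff_gen_sum, map_sum, map_sum, LinearMap.sum_apply, Finset.smul_sum,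
    Finset.smul_sum, Finset.smul_sum]
  · congr 1
    · refine Finset.sum_congr rfl fun e he => ?_
      rw [gen_eq_oriented V, circTo_oriented hN hi him ?_ hV, V.deg_eq_length]
      · rfl
      · intro f hf
        rcases List.mem_cons.1 hf with rfl | hf
        · exact mem_internalEdges.1 he
        · exact hU f hf
    · refine Finset.sum_congr rfl fun e he => ?_
      rw [gen_eq_oriented U, circTo_oriented hN hi him hU ?_, smul_smul]
      · have h := (oriented_alternating (K := K) N).move (K := K) (e.inner i) []
          (U.edgeList.map (Edge.outer i n))
          (V.edgeList.map (Edge.inner i) ++ [⟨i, i + n - 1⟩])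
        simp only [List.nil_append, List.append_assoc, List.map_cons, List.cons_append] at h ⊢
        rw [h, smul_smul, ← zpow_natCast, neg_one_zpow_add, neg_one_zpow_add]
        congr 1
        apply neg_one_zpow_congr
        rw [U.deg_eq_length, V.deg_eq_length, List.length_map, List.length_cons]
        push_cast
        generalize (i : ZMod 2) = i, (m : ZMod 2) = m, (n : ZMod 2) = n, (U.edgeList.length : ZMod 2) = u, (V.edgeList.length : ZMod 2) = v
        decide +revert
      · intro f hf
        rcases List.mem_cons.1 hf with rfl | hf
        · exact mem_internalEdges.1 he
        · exact hV f hf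
  · intro e he
    refine oriented_of_not fun h => he ?_
    exact (isTreeList_cons.1 h).2.1 _ (by simp)

/-- The differential is a derivation of the compositions. -/
theorem diff_circTo {m n i N : ℕ} (hN : N = m + n - 1) (hi : 1 ≤ i) (him : i ≤ m)
    (x : AInf K m) (y : AInf K n) :
    diff K N (circTo K m n i N x y) =
      circTo K m n i N (diff K m x) y + circTo K m n i N (signOp K m x) (diff K n y) := by
  have h : (circTo K m n i N).compr₂ (diff K N) =
      (circTo K m n i N).comp (diff K m) +
        (circTo K m n i N).compl₁₂ (signOp K m) (diff K n) := by
    refine AInf_hom_ext fun U => AInf_hom_ext fun V => ?_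
    simpa [signOp_gen] using diff_circTo_gen hN hi him U V
  exact LinearMap.congr_fun₂ h x y

theorem circTo_gen_internal {m n i N : ℕ} (hN : N = m + n - 1) (hi : 1 ≤ i) (him : i ≤ m)
    (U : PlanarTree m) (V : PlanarTree n) :
    IsTreeList N
      (U.edgeList.map (Edge.outer i n) ++ V.edgeList.map (Edge.inner i) ++ [⟨i, i + n - 1⟩]) :=
  (isTreeList_graft_iff hN hi him (fun _ he => U.internal he) (fun _ he => V.internal he)).2
    ⟨U.isTreeList, V.isTreeList⟩

/-- Associativity of two compositions in a row. -/
theorem circTo_assoc_gen {m n p i j M M' N : ℕ} (hM : M = m + n - 1) (hM' : M' = n + p - 1)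
    (hN : N = M + p - 1) (hi : 1 ≤ i) (him : i ≤ m) (hj : 1 ≤ j) (hjn : j ≤ n)
    (U : PlanarTree m) (V : PlanarTree n) (W : PlanarTree p) :
    circTo K M p (i + j - 1) N (circTo K m n i M (gen U) (gen V)) (gen W) =
      circTo K m M' i N (gen U) (circTo K n p j M' (gen V) (gen W)) := by
  have hn := V.two_le
  have hp := W.two_le
  rw [circTo_gen, circTo_gen, map_smul, map_smul, LinearMap.smul_apply, gen_eq_oriented W,
    gen_eq_oriented U,
    circTo_oriented hN (by omega) (by omega)
      (fun _ h => (circTo_gen_internal hM hi him U V).internal h) (fun _ h => W.internal h),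
    circTo_oriented (by omega) hi him (fun _ h => U.internal h)
      (fun _ h => (circTo_gen_internal hM' hj hjn V W).internal h),
    smul_smul, smul_smul, neg_one_zpow_add, neg_one_zpow_add]
  have e1 : (U.edgeList.map (Edge.outer i n)).map (Edge.outer (i + j - 1) p) =
      U.edgeList.map (Edge.outer i M') := by
    rw [List.map_map]
    refine List.map_congr_left fun e he => ?_
    have := U.internal he
    simp only [Edge.IsInternal] at this
    grind [Edge.outer, Edge.inner, Edge.rotate]
  have e2 : (V.edgeList.map (Edge.inner i)).map (Edge.outer (i + j - 1) p) =
      (V.edgeList.map (Edge.outer j p)).map (Edge.inner i) := by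
    rw [List.map_map, List.map_map]
    refine List.map_congr_left fun e he => ?_
    grind [Edge.outer, Edge.inner, Edge.rotate]
  have e3 : W.edgeList.map (Edge.inner (i + j - 1)) =
      (W.edgeList.map (Edge.inner j)).map (Edge.inner i) := by
    rw [List.map_map]
    refine List.map_congr_left fun e he => ?_
    grind [Edge.outer, Edge.inner, Edge.rotate]
  have e4 : Edge.outer (i + j - 1) p ⟨i, i + n - 1⟩ = ⟨i, i + M' - 1⟩ := by
    grind [Edge.outer, Edge.inner, Edge.rotate]
  have e5 : (⟨i + j - 1, i + j - 1 + p - 1⟩ : Edge) = Edge.inner i ⟨j, j + p - 1⟩ := by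
    grind [Edge.outer, Edge.inner, Edge.rotate]
  have h := oriented_append_comm (K := K) N
    (U.edgeList.map (Edge.outer i M') ++ (V.edgeList.map (Edge.outer j p)).map (Edge.inner i))
    [⟨i, i + M' - 1⟩]
    ((W.edgeList.map (Edge.inner j)).map (Edge.inner i) ++ [Edge.inner i ⟨j, j + p - 1⟩]) []
  simp only [List.map_append, List.map_cons, List.map_nil, e1, e2, e3, e4, e5]
  simp only [List.append_assoc, List.append_nil, List.length_append, List.length_map,
    List.length_cons, List.length_nil] at h ⊢
  rw [h, smul_smul, neg_one_zpow_add]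
  congr 1
  apply neg_one_zpow_congr
  rw [W.deg_eq_length, V.deg_eq_length, hM, hM']
  push_cast [Nat.cast_sub (show 1 ≤ i + j by omega), Nat.cast_sub (show 1 ≤ n + p by omega),
    Nat.cast_sub (show 1 ≤ m + n by omega)]
  generalize (i : ZMod 2) = i, (m : ZMod 2) = m, (n : ZMod 2) = n, (p : ZMod 2) = p, (j : ZMod 2) = j, (U.edgeList.length : ZMod 2) = u, (V.edgeList.length : ZMod 2) = v, (W.edgeList.length : ZMod 2) = w
  decide +revert

/-- Associativity of two compositions at different leaves. -/
theorem circTo_comm_gen {m n p i k M M' N : ℕ} (hM : M = m + n - 1) (hM' : M' = m + p - 1)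
    (hN : N = M + p - 1) (hi : 1 ≤ i) (hik : i < k) (hkm : k ≤ m)
    (U : PlanarTree m) (V : PlanarTree n) (W : PlanarTree p) :
    circTo K M p (k + n - 1) N (circTo K m n i M (gen U) (gen V)) (gen W) =
      (-1 : K) ^ (V.deg * W.deg) •
        circTo K M' n i N (circTo K m p k M' (gen U) (gen W)) (gen V) := by
  have hn := V.two_le
  have hp := W.two_le
  rw [circTo_gen, circTo_gen, map_smul, map_smul, LinearMap.smul_apply, LinearMap.smul_apply,
    gen_eq_oriented W, gen_eq_oriented V,
    circTo_oriented hN (by omega) (by omega)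
      (fun _ h => (circTo_gen_internal hM hi (by omega) U V).internal h)
      (fun _ h => W.internal h),
    circTo_oriented (by omega) hi (by omega)
      (fun _ h => (circTo_gen_internal hM' (by omega) hkm U W).internal h)
      (fun _ h => V.internal h),
    smul_smul, smul_smul, smul_smul, neg_one_zpow_add, neg_one_zpow_add, neg_one_zpow_add]
  have e1 : (U.edgeList.map (Edge.outer i n)).map (Edge.outer (k + n - 1) p) =
      (U.edgeList.map (Edge.outer k p)).map (Edge.outer i n) := by
    rw [List.map_map, List.map_map]
    refine List.map_congr_left fun e he => ?_
    have := U.internal he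
    simp only [Edge.IsInternal] at this
    grind [Edge.outer, Edge.inner, Edge.rotate]
  have e2 : (V.edgeList.map (Edge.inner i)).map (Edge.outer (k + n - 1) p) =
      V.edgeList.map (Edge.inner i) := by
    rw [List.map_map]
    refine List.map_congr_left fun e he => ?_
    have := V.internal he
    simp only [Edge.IsInternal] at this
    grind [Edge.outer, Edge.inner, Edge.rotate]
  have e3 : W.edgeList.map (Edge.inner (k + n - 1)) =
      (W.edgeList.map (Edge.inner k)).map (Edge.outer i n) := by
    rw [List.map_map]
    refine List.map_congr_left fun e he => ?_
    have := W.internal he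
    simp only [Edge.IsInternal] at this
    grind [Edge.outer, Edge.inner, Edge.rotate]
  have e4 : Edge.outer (k + n - 1) p ⟨i, i + n - 1⟩ = ⟨i, i + n - 1⟩ := by
    grind [Edge.outer, Edge.inner, Edge.rotate]
  have e5 : (⟨k + n - 1, k + n - 1 + p - 1⟩ : Edge) = Edge.outer i n ⟨k, k + p - 1⟩ := by
    grind [Edge.outer, Edge.inner, Edge.rotate]
  have h := oriented_append_comm (K := K) N
    ((U.edgeList.map (Edge.outer k p)).map (Edge.outer i n))
    (V.edgeList.map (Edge.inner i) ++ [⟨i, i + n - 1⟩])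
    ((W.edgeList.map (Edge.inner k)).map (Edge.outer i n) ++ [Edge.outer i n ⟨k, k + p - 1⟩]) []
  simp only [List.map_append, List.map_cons, List.map_nil, e1, e2, e3, e4, e5]
  simp only [List.append_assoc, List.append_nil, List.length_append, List.length_map,
    List.length_cons, List.length_nil] at h ⊢
  rw [h, smul_smul, neg_one_zpow_add]
  congr 1
  apply neg_one_zpow_congr
  rw [W.deg_eq_length, V.deg_eq_length, hM, hM']
  push_cast [Nat.cast_sub (show 1 ≤ k + n by omega), Nat.cast_sub (show 1 ≤ m + p by omega),
    Nat.cast_sub (show 1 ≤ m + n by omega)]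
  generalize (i : ZMod 2) = i, (m : ZMod 2) = m, (n : ZMod 2) = n, (p : ZMod 2) = p, (k : ZMod 2) = k, (U.edgeList.length : ZMod 2) = u, (V.edgeList.length : ZMod 2) = v, (W.edgeList.length : ZMod 2) = w
  decide +revert

theorem rot_circTo_gen {m n i N : ℕ} (hN : N = m + n - 1) (hi : 1 ≤ i) (him : i < m)
    (U : PlanarTree m) (V : PlanarTree n) :
    rot K N (circTo K m n i N (gen U) (gen V)) =
      circTo K m n (i + 1) N (rot K m (gen U)) (gen V) := by
  have hn := V.two_le
  rw [circTo_gen, map_smul,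
    rot_oriented fun _ h => (circTo_gen_internal hN hi him.le U V).internal h, rot_gen, map_smul,
    LinearMap.smul_apply, gen_eq_oriented V, circTo_oriented hN (by omega) (by omega) ?_
    fun _ h => V.internal h, smul_smul, smul_smul]
  · have e1 : (U.edgeList.map (Edge.outer i n)).map (Edge.rotate N) =
        (U.edgeList.map (Edge.rotate m)).map (Edge.outer (i + 1) n) := by
      rw [List.map_map, List.map_map]
      refine List.map_congr_left fun e he => ?_
      have := U.internal he
      simp only [Edge.IsInternal] at this
      grind [Edge.outer, Edge.inner, Edge.rotate]
    have e2 : (V.edgeList.map (Edge.inner i)).map (Edge.rotate N) =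
        V.edgeList.map (Edge.inner (i + 1)) := by
      rw [List.map_map]
      refine List.map_congr_left fun e he => ?_
      have := V.internal he
      simp only [Edge.IsInternal] at this
      grind [Edge.outer, Edge.inner, Edge.rotate]
    have e3 : Edge.rotate N ⟨i, i + n - 1⟩ = ⟨i + 1, i + 1 + n - 1⟩ := by
      grind [Edge.outer, Edge.inner, Edge.rotate]
    simp only [List.map_append, List.map_cons, List.map_nil, e1, e2, e3]
    congr 1
    rw [← zpow_natCast, ← zpow_natCast, neg_one_zpow_add, neg_one_zpow_add]
    apply neg_one_zpow_congr
    rw [V.deg_eq_length, hN]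
    push_cast [Nat.cast_sub (show 1 ≤ m + n by omega)]
    generalize (i : ZMod 2) = i, (m : ZMod 2) = m, (n : ZMod 2) = n, (V.edgeList.length : ZMod 2) = v
    decide +revert
  · intro f hf
    rw [List.mem_map] at hf
    obtain ⟨e, he, rfl⟩ := hf
    exact Edge.rotate_internal (U.internal he)

theorem rot_circTo_last_gen {m n N : ℕ} (hN : N = m + n - 1)
    (U : PlanarTree m) (V : PlanarTree n) :
    rot K N (circTo K m n m N (gen U) (gen V)) = (-1 : K) ^ (U.deg * V.deg) •
      circTo K n m 1 N (rot K n (gen V)) (rot K m (gen U)) := by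
  have hn := V.two_le
  have hm := U.two_le
  rw [circTo_gen, map_smul,
    rot_oriented fun _ h => (circTo_gen_internal hN (by omega) le_rfl U V).internal h, rot_gen,
    rot_gen, map_smul, map_smul, LinearMap.smul_apply,
    circTo_oriented (by omega) le_rfl (by omega), smul_smul, smul_smul, smul_smul, smul_smul]
  · have e1 : (U.edgeList.map (Edge.outer m n)).map (Edge.rotate N) =
        (U.edgeList.map (Edge.rotate m)).map (Edge.inner 1) := by
      rw [List.map_map, List.map_map]
      refine List.map_congr_left fun e he => ?_
      have := U.internal he
      simp only [Edge.IsInternal] at this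
      grind [Edge.outer, Edge.inner, Edge.rotate]
    have e2 : (V.edgeList.map (Edge.inner m)).map (Edge.rotate N) =
        (V.edgeList.map (Edge.rotate n)).map (Edge.outer 1 m) := by
      rw [List.map_map, List.map_map]
      refine List.map_congr_left fun e he => ?_
      have := V.internal he
      simp only [Edge.IsInternal] at this
      grind [Edge.outer, Edge.inner, Edge.rotate]
    have e3 : Edge.rotate N ⟨m, m + n - 1⟩ = ⟨1, 1 + m - 1⟩ := by
      grind [Edge.outer, Edge.inner, Edge.rotate]
    have h := oriented_append_comm (K := K) N []
      ((U.edgeList.map (Edge.rotate m)).map (Edge.inner 1))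
      ((V.edgeList.map (Edge.rotate n)).map (Edge.outer 1 m)) [⟨1, 1 + m - 1⟩]
    simp only [List.map_append, List.map_cons, List.map_nil, e1, e2, e3]
    simp only [List.nil_append, List.length_map] at h ⊢
    rw [h, smul_smul]
    congr 1
    simp only [← zpow_natCast, neg_one_zpow_add]
    apply neg_one_zpow_congr
    rw [U.deg_eq_length, V.deg_eq_length, hN]
    push_cast [Nat.cast_sub (show 1 ≤ m + n by omega)]
    generalize (m : ZMod 2) = m, (n : ZMod 2) = n, (U.edgeList.length : ZMod 2) = u, (V.edgeList.length : ZMod 2) = v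
    decide +revert
  · intro f hf
    rw [List.mem_map] at hf
    obtain ⟨e, he, rfl⟩ := hf
    exact Edge.rotate_internal (V.internal he)
  · intro f hf
    rw [List.mem_map] at hf
    obtain ⟨e, he, rfl⟩ := hf
    exact Edge.rotate_internal (U.internal he)

/-! ### Rotation and degrees -/

theorem unrotate {n : ℕ} {e : Edge} (he : e.IsInternal n) :
    ∃ e' : Edge, e'.IsInternal n ∧ e'.rotate n = e := by
  obtain ⟨a, b⟩ := e
  simp only [Edge.IsInternal] at he
  by_cases h : a = 1
  · refine ⟨⟨b, n⟩, ?_⟩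
    simp only [Edge.IsInternal]
    grind [Edge.rotate]
  · refine ⟨⟨a - 1, b - 1⟩, ?_⟩
    simp only [Edge.IsInternal]
    grind [Edge.rotate]

theorem sum_internalEdges_rotate {n : ℕ} {W : Type*} [AddCommGroup W] (F : Edge → W) :
    ∑ e ∈ internalEdges n, F (e.rotate n) = ∑ e ∈ internalEdges n, F e := by
  refine Finset.sum_bij (fun e _ => e.rotate n) ?_ ?_ ?_ fun _ _ => rfl
  · intro e he
    exact mem_internalEdges.2 (Edge.rotate_internal (mem_internalEdges.1 he))
  · intro e he f hf h
    rw [mem_internalEdges] at he hf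
    by_contra hne
    simp only [Edge.IsInternal] at he hf
    grind [Edge.rotate, Edge.ext]
  · intro e he
    obtain ⟨e', h, h'⟩ := unrotate (mem_internalEdges.1 he)
    exact ⟨e', mem_internalEdges.2 h, h'⟩

theorem diff_rot {n : ℕ} (x : AInf K n) : diff K n (rot K n x) = rot K n (diff K n x) := by
  suffices h : diff K n ∘ₗ rot K n = rot K n ∘ₗ diff K n from LinearMap.congr_fun h x
  refine AInf_hom_ext fun T => ?_
  rw [LinearMap.comp_apply, LinearMap.comp_apply, rot_gen, map_smul, diff_oriented, diff_gen_sum,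
    map_sum, Finset.smul_sum, ← sum_internalEdges_rotate]
  refine Finset.sum_congr rfl fun e he => ?_
  rw [rot_oriented]
  · rfl
  · intro f hf
    rcases List.mem_cons.1 hf with rfl | hf
    · exact mem_internalEdges.1 he
    · exact T.internal hf

theorem rot_iterate {n : ℕ} (T : PlanarTree n) (k : ℕ) :
    (rot K n ^ k) (gen T) =
      (-1 : K) ^ (n * k) • oriented K n (T.edgeList.map (Edge.rotate n)^[k]) := by
  have hi : ∀ k, ∀ e ∈ T.edgeList.map (Edge.rotate n)^[k], e.IsInternal n := by
    intro k
    induction k with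
    | zero => simpa using fun e he => T.internal he
    | succ k ih =>
      intro e he
      rw [Function.iterate_succ', ← List.map_map, List.mem_map] at he
      obtain ⟨f, hf, rfl⟩ := he
      exact Edge.rotate_internal (ih f hf)
  induction k with
  | zero => simp [gen_eq_oriented]
  | succ k ih =>
    rw [pow_succ', Module.End.mul_apply, ih, map_smul, rot_oriented (hi k), smul_smul, ← pow_add,
      List.map_map, Function.iterate_succ']
    rfl

theorem rot_pow (n : ℕ) : rot K n ^ (n + 1) = 1 := by
  refine AInf_hom_ext fun T => ?_
  rw [rot_iterate, Even.neg_one_pow (Nat.even_mul_succ_self n), one_smul, Module.End.one_apply,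
    gen_eq_oriented]
  congr 1
  conv_rhs => rw [← List.map_id T.edgeList]
  exact List.map_congr_left fun e he => Edge.iterate_rotate (T.internal he)

theorem oriented_mem {n : ℕ} {l : List Edge} {k : ℤ} (h : k = (n : ℤ) - 2 - l.length) :
    oriented K n l ∈ piece K n k := h ▸ oriented_mem_piece n l

theorem piece_induction {n : ℕ} {k : ℤ} {W : Type*} [AddCommGroup W] [Module K W]
    {f : AInf K n →ₗ[K] W} {S : Submodule K W} (h : ∀ T : PlanarTree n, T.deg = k → f (gen T) ∈ S)
    {x : AInf K n} (hx : x ∈ piece K n k) : f x ∈ S := by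
  have : piece K n k ≤ S.comap f := by
    rw [piece, Submodule.span_le]
    rintro _ ⟨T, hT, rfl⟩
    exact h T hT
  exact this hx

theorem diff_mem_piece {n : ℕ} {k : ℤ} {x : AInf K n} (hx : x ∈ piece K n k) :
    diff K n x ∈ piece K n (k - 1) := by
  refine piece_induction (fun T hT => ?_) hx
  rw [diff_gen_sum]
  refine Submodule.sum_mem _ fun e _ => oriented_mem ?_
  rw [← hT, T.deg_eq_length, List.length_cons]
  push_cast
  ring

theorem signOp_mem_piece {n : ℕ} {k : ℤ} {x : AInf K n} (hx : x ∈ piece K n k) :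
    signOp K n x ∈ piece K n k := by
  rw [signOp_of_mem hx]
  exact Submodule.smul_mem _ _ hx

theorem rot_mem_piece {n : ℕ} {k : ℤ} {x : AInf K n} (hx : x ∈ piece K n k) :
    rot K n x ∈ piece K n k := by
  refine piece_induction (fun T hT => ?_) hx
  rw [rot_gen]
  refine Submodule.smul_mem _ _ (oriented_mem ?_)
  rw [← hT, T.deg_eq_length, List.length_map]

theorem circTo_mem_piece {m n i N : ℕ} (hN : N = m + n - 1) {p q : ℤ} {x : AInf K m} {y : AInf K n}
    (hx : x ∈ piece K m p) (hy : y ∈ piece K n q) :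
    circTo K m n i N x y ∈ piece K N (p + q) := by
  refine piece_induction (f := (circTo K m n i N).flip y) (fun U hU => ?_) hx
  refine piece_induction (f := circTo K m n i N (gen U)) (fun V hV => ?_) hy
  rw [circTo_gen]
  refine Submodule.smul_mem _ _ (oriented_mem ?_)
  have := U.two_le
  rw [← hU, ← hV, U.deg_eq_length, V.deg_eq_length, hN]
  simp only [List.length_append, List.length_map, List.length_cons, List.length_nil]
  push_cast [Nat.cast_sub (show 1 ≤ m + n by omega)]
  ring

/-! ### The operad identities in `A∞ ⊗ A∞` -/

variable (K) in
/-- The composition `∘_i` of `A∞ ⊗ A∞` with values in arity `N`, to be used with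
`N = m + n - 1`. -/
def circSqTo (m n i N : ℕ) : AInfSq K m →ₗ[K] AInfSq K n →ₗ[K] AInfSq K N :=
  ((treeBasis K m).tensorProduct (treeBasis K m)).constr K fun U =>
    ((treeBasis K n).tensorProduct (treeBasis K n)).constr K fun V =>
      (-1 : K) ^ (U.2.deg * V.1.deg) •
        (circTo K m n i N (gen U.1) (gen V.1) ⊗ₜ[K] circTo K m n i N (gen U.2) (gen V.2))

theorem circSqTo_gen (m n i N : ℕ) (U₁ U₂ : PlanarTree m) (V₁ V₂ : PlanarTree n) :
    circSqTo K m n i N (gen U₁ ⊗ₜ[K] gen U₂) (gen V₁ ⊗ₜ[K] gen V₂) =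
      (-1 : K) ^ (U₂.deg * V₁.deg) • (circTo K m n i N (gen U₁) (gen V₁) ⊗ₜ[K]
        circTo K m n i N (gen U₂) (gen V₂)) := by
  have h1 : ∀ {k : ℕ} (U V : PlanarTree k), (gen U : AInf K k) ⊗ₜ[K] gen V =
      (treeBasis K k).tensorProduct (treeBasis K k) (U, V) := by
    intro k U V
    rw [Module.Basis.tensorProduct_apply]
    rfl
  rw [circSqTo, h1, h1, Module.Basis.constr_basis, Module.Basis.constr_basis]

theorem AInfSq_hom_ext {n : ℕ} {W : Type*} [AddCommGroup W] [Module K W]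
    {f g : AInfSq K n →ₗ[K] W} (h : ∀ U V, f (gen U ⊗ₜ[K] gen V) = g (gen U ⊗ₜ[K] gen V)) :
    f = g :=
  TensorProduct.ext (AInf_hom_ext fun U => AInf_hom_ext fun V => h U V)

theorem circSqTo_tmul (m n i N : ℕ) {a b : ℤ} (x₁ : AInf K m) {x₂ : AInf K m}
    (hx : x₂ ∈ piece K m a) {y₁ : AInf K n} (hy : y₁ ∈ piece K n b) (y₂ : AInf K n) :
    circSqTo K m n i N (x₁ ⊗ₜ[K] x₂) (y₁ ⊗ₜ[K] y₂) =
      (-1 : K) ^ (a * b) • (circTo K m n i N x₁ y₁ ⊗ₜ[K] circTo K m n i N x₂ y₂) := by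
  induction hx using Submodule.span_induction with
  | zero => simp
  | add x x' _ _ h h' => simp only [TensorProduct.tmul_add, map_add, LinearMap.add_apply, h, h',
      smul_add]
  | smul c x _ h => simp only [TensorProduct.tmul_smul, map_smul, LinearMap.smul_apply, h,
      smul_comm c]
  | mem x h =>
    obtain ⟨U, rfl, rfl⟩ := h
    induction hy using Submodule.span_induction with
    | zero => simp
    | add x x' _ _ h h' => simp only [TensorProduct.add_tmul, map_add, h,
        h', smul_add]
    | smul c x _ h => simp only [← TensorProduct.smul_tmul', map_smul, h, smul_comm c]
    | mem x h =>
      obtain ⟨V, rfl, rfl⟩ := h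
      have h1 : ((circSqTo K m n i N).compl₁₂
          (LinearMap.flip (TensorProduct.mk K _ _) (gen U))
          (TensorProduct.mk K _ _ (gen V))) =
          (-1 : K) ^ (U.deg * V.deg) • (TensorProduct.mk K _ _).compl₁₂
            ((circTo K m n i N).flip (gen V)) (circTo K m n i N (gen U)) := by
        refine AInf_hom_ext fun U' => AInf_hom_ext fun V' => ?_
        simpa using circSqTo_gen m n i N U' U V V'
      simpa using LinearMap.congr_fun₂ h1 x₁ y₂

theorem signOp_map_gen {n : ℕ} (U V : PlanarTree n) :
    TensorProduct.map (signOp K n) (signOp K n) (gen U ⊗ₜ[K] gen V) =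
      (-1 : K) ^ (U.deg + V.deg) • (gen U ⊗ₜ[K] gen V) := by
  rw [TensorProduct.map_tmul, signOp_gen, signOp_gen, TensorProduct.smul_tmul_smul,
    neg_one_zpow_add]

theorem gen_tmul_mem {n : ℕ} (U V : PlanarTree n) :
    (gen U ⊗ₜ[K] gen V : AInfSq K n) ∈ pieceSq K n (U.deg + V.deg) :=
  Submodule.subset_span ⟨U, V, rfl, rfl⟩

theorem pieceSq_induction {n : ℕ} {k : ℤ} {W : Type*} [AddCommGroup W] [Module K W]
    {f : AInfSq K n →ₗ[K] W} {S : Submodule K W}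
    (h : ∀ U V : PlanarTree n, U.deg + V.deg = k → f (gen U ⊗ₜ[K] gen V) ∈ S)
    {x : AInfSq K n} (hx : x ∈ pieceSq K n k) : f x ∈ S := by
  have : pieceSq K n k ≤ S.comap f := by
    rw [pieceSq, Submodule.span_le]
    rintro _ ⟨U, V, hT, rfl⟩
    exact h U V hT
  exact this hx

theorem tmul_mem_pieceSq {n : ℕ} {p q k : ℤ} (hk : p + q = k) {x y : AInf K n}
    (hx : x ∈ piece K n p) (hy : y ∈ piece K n q) : x ⊗ₜ[K] y ∈ pieceSq K n k := by
  refine piece_induction (f := (TensorProduct.mk K _ _).flip y) (fun U hU => ?_) hx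
  refine piece_induction (f := TensorProduct.mk K _ _ (gen U)) (fun V hV => ?_) hy
  rw [← hk, ← hU, ← hV]
  exact gen_tmul_mem U V

theorem rotSq_mem_pieceSq {n : ℕ} {k : ℤ} {x : AInfSq K n} (hx : x ∈ pieceSq K n k) :
    rotSq K n x ∈ pieceSq K n k := by
  refine pieceSq_induction (fun U V h => ?_) hx
  exact tmul_mem_pieceSq h (rot_mem_piece (gen_mem_piece U)) (rot_mem_piece (gen_mem_piece V))

theorem circSqTo_mem_pieceSq {m n i N : ℕ} (hN : N = m + n - 1) {p q : ℤ} {x : AInfSq K m}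
    {y : AInfSq K n} (hx : x ∈ pieceSq K m p) (hy : y ∈ pieceSq K n q) :
    circSqTo K m n i N x y ∈ pieceSq K N (p + q) := by
  refine pieceSq_induction (f := (circSqTo K m n i N).flip y) (fun U U' hU => ?_) hx
  refine pieceSq_induction (f := circSqTo K m n i N _) (fun V V' hV => ?_) hy
  rw [circSqTo_gen]
  exact Submodule.smul_mem _ _ (tmul_mem_pieceSq (by omega)
    (circTo_mem_piece hN (gen_mem_piece U) (gen_mem_piece V))
    (circTo_mem_piece hN (gen_mem_piece U') (gen_mem_piece V')))

theorem signOp_map_of_mem {n : ℕ} {k : ℤ} {x : AInfSq K n} (hx : x ∈ pieceSq K n k) :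
    TensorProduct.map (signOp K n) (signOp K n) x = (-1 : K) ^ k • x := by
  have h := pieceSq_induction (f := TensorProduct.map (signOp K n) (signOp K n) -
    (-1 : K) ^ k • LinearMap.id) (S := ⊥) (fun U V h => ?_) hx
  · simpa [sub_eq_zero] using h
  · rw [LinearMap.sub_apply, signOp_map_gen, h]
    exact sub_self _

/-- The differential is a derivation of the compositions in the tensor square. The Koszul sign
`(-1)^{|U₂||V₁|}` of the composition makes both tensor factors agree. -/
theorem diffSq_circSqTo {m n i N : ℕ} (hN : N = m + n - 1) (hi : 1 ≤ i) (him : i ≤ m)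
    (x : AInfSq K m) (y : AInfSq K n) :
    diffSq K N (circSqTo K m n i N x y) = circSqTo K m n i N (diffSq K m x) y +
      circSqTo K m n i N (TensorProduct.map (signOp K m) (signOp K m) x) (diffSq K n y) := by
  have h : (circSqTo K m n i N).compr₂ (diffSq K N) =
      (circSqTo K m n i N).comp (diffSq K m) + (circSqTo K m n i N).compl₁₂
        (TensorProduct.map (signOp K m) (signOp K m)) (diffSq K n) := by
    refine AInfSq_hom_ext fun U U' => AInfSq_hom_ext fun V V' => ?_
    simp only [LinearMap.compr₂_apply, LinearMap.add_apply, LinearMap.comp_apply,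
      LinearMap.compl₁₂_apply, signOp_map_gen, map_smul, LinearMap.smul_apply, circSqTo_gen,
      diffSq_tmul, map_add]
    have h1 := gen_mem_piece (K := K) U
    have h1' := gen_mem_piece (K := K) U'
    have h2 := gen_mem_piece (K := K) V
    have h2' := gen_mem_piece (K := K) V'
    rw [signOp_gen, signOp_gen, ← TensorProduct.smul_tmul', ← TensorProduct.smul_tmul', map_smul,
      map_smul, LinearMap.smul_apply,
      circSqTo_tmul _ _ _ _ _ h1' h2, circSqTo_tmul _ _ _ _ _ (diff_mem_piece h1') h2,
      circSqTo_tmul _ _ _ _ _ h1' (diff_mem_piece h2), circSqTo_tmul _ _ _ _ _ h1' h2,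
      diff_circTo hN hi him, diff_circTo hN hi him, signOp_of_mem (circTo_mem_piece hN h1 h2),
      signOp_gen, signOp_gen]
    simp only [map_smul, LinearMap.smul_apply, TensorProduct.add_tmul, TensorProduct.tmul_add,
      smul_add, ← TensorProduct.smul_tmul', TensorProduct.tmul_smul, smul_smul, neg_one_zpow_add]
    rw [neg_one_zpow_congr (K := K) (a := U.deg + U'.deg + U'.deg * (V.deg - 1))
        (b := U'.deg * V.deg + U.deg) ?_,
      neg_one_zpow_congr (K := K) (a := U.deg + (U'.deg - 1) * V.deg)
        (b := U'.deg * V.deg + (U.deg + V.deg)) ?_,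
      neg_one_zpow_congr (K := K) (a := U.deg + U'.deg + (V.deg + U'.deg * V.deg))
        (b := U'.deg * V.deg + (U.deg + V.deg) + U'.deg) ?_]
    · abel_nf
    all_goals
      push_cast
      generalize (U.deg : ZMod 2) = a, (U'.deg : ZMod 2) = b, (V.deg : ZMod 2) = c
      decide +revert
  exact LinearMap.congr_fun₂ h x y

/-- Sequential associativity of the compositions in the tensor square. -/
theorem circSqTo_assoc {m n p i j M M' N : ℕ} (hM : M = m + n - 1) (hM' : M' = n + p - 1)
    (hN : N = M + p - 1) (hi : 1 ≤ i) (him : i ≤ m) (hj : 1 ≤ j) (hjn : j ≤ n)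
    (x : AInfSq K m) (y : AInfSq K n) (z : AInfSq K p) :
    circSqTo K M p (i + j - 1) N (circSqTo K m n i M x y) z =
      circSqTo K m M' i N x (circSqTo K n p j M' y z) := by
  have h : (circSqTo K m n i M).compr₂ (circSqTo K M p (i + j - 1) N) =
      ((LinearMap.llcomp K (AInfSq K p) (AInfSq K M') (AInfSq K N)).compl₁₂
        (circSqTo K m M' i N) (circSqTo K n p j M')) := by
    refine AInfSq_hom_ext fun U U' => AInfSq_hom_ext fun V V' => AInfSq_hom_ext fun W W' => ?_
    have h2 := gen_mem_piece (K := K) V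
    have h2' := gen_mem_piece (K := K) V'
    have h1' := gen_mem_piece (K := K) U'
    have h3 := gen_mem_piece (K := K) W
    simp only [LinearMap.compr₂_apply, LinearMap.compl₁₂_apply, LinearMap.llcomp_apply,
      circSqTo_gen, map_smul, LinearMap.smul_apply]
    rw [circSqTo_tmul _ _ _ _ _ (circTo_mem_piece hM h1' h2') h3,
      circSqTo_tmul _ _ _ _ _ h1' (circTo_mem_piece hM' h2 h3),
      circTo_assoc_gen hM hM' hN hi him hj hjn, circTo_assoc_gen hM hM' hN hi him hj hjn,
      smul_smul, smul_smul, neg_one_zpow_add, neg_one_zpow_add]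
    congr 2
    ring
  exact LinearMap.congr_fun (LinearMap.congr_fun₂ h x y) z

/-- Parallel associativity of the compositions in the tensor square, with its Koszul sign. -/
theorem circSqTo_comm {m n p i k M M' N : ℕ} (hM : M = m + n - 1) (hM' : M' = m + p - 1)
    (hN : N = M + p - 1) (hi : 1 ≤ i) (hik : i < k) (hkm : k ≤ m) {s t : ℤ}
    (x : AInfSq K m) {y : AInfSq K n} (hy : y ∈ pieceSq K n s) {z : AInfSq K p}
    (hz : z ∈ pieceSq K p t) :
    circSqTo K M p (k + n - 1) N (circSqTo K m n i M x y) z =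
      (-1 : K) ^ (s * t) • circSqTo K M' n i N (circSqTo K m p k M' x z) y := by
  rw [← sub_eq_zero, ← Submodule.mem_bot K]
  refine pieceSq_induction (f := (circSqTo K M p (k + n - 1) N).flip z ∘ₗ circSqTo K m n i M x -
    (-1 : K) ^ (s * t) • circSqTo K M' n i N (circSqTo K m p k M' x z)) (fun V V' hV => ?_) hy
  refine pieceSq_induction (f := circSqTo K M p (k + n - 1) N
      (circSqTo K m n i M x (gen V ⊗ₜ[K] gen V')) -
    (-1 : K) ^ (s * t) • (circSqTo K M' n i N).flip (gen V ⊗ₜ[K] gen V') ∘ₗ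
      circSqTo K m p k M' x) (fun W W' hW => ?_) hz
  rw [Submodule.mem_bot, LinearMap.sub_apply, sub_eq_zero]
  suffices h : (circSqTo K M p (k + n - 1) N).flip (gen W ⊗ₜ[K] gen W') ∘ₗ
      (circSqTo K m n i M).flip (gen V ⊗ₜ[K] gen V') =
      (-1 : K) ^ (s * t) • (circSqTo K M' n i N).flip (gen V ⊗ₜ[K] gen V') ∘ₗ
      (circSqTo K m p k M').flip (gen W ⊗ₜ[K] gen W') from LinearMap.congr_fun h x
  refine AInfSq_hom_ext fun U U' => ?_
  have h2 := gen_mem_piece (K := K) V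
  have h2' := gen_mem_piece (K := K) V'
  have h1' := gen_mem_piece (K := K) U'
  have h3 := gen_mem_piece (K := K) W
  have h3' := gen_mem_piece (K := K) W'
  simp only [LinearMap.comp_apply, LinearMap.smul_apply, LinearMap.flip_apply, circSqTo_gen,
    map_smul]
  rw [circSqTo_tmul _ _ _ _ _ (circTo_mem_piece hM h1' h2') h3,
    circSqTo_tmul _ _ _ _ _ (circTo_mem_piece hM' h1' h3') h2,
    circTo_comm_gen hM hM' hN hi hik hkm, circTo_comm_gen hM hM' hN hi hik hkm]
  simp only [TensorProduct.smul_tmul_smul, smul_smul, neg_one_zpow_add]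
  congr 1
  apply neg_one_zpow_congr
  rw [← hV, ← hW]
  push_cast
  generalize (U'.deg : ZMod 2) = a, (V'.deg : ZMod 2) = b, (V.deg : ZMod 2) = c,
    (W.deg : ZMod 2) = d, (W'.deg : ZMod 2) = e
  decide +revert

theorem rotSq_circSqTo {m n i N : ℕ} (hN : N = m + n - 1) (hi : 1 ≤ i) (him : i < m)
    (x : AInfSq K m) (y : AInfSq K n) :
    rotSq K N (circSqTo K m n i N x y) = circSqTo K m n (i + 1) N (rotSq K m x) y := by
  have h : (circSqTo K m n i N).compr₂ (rotSq K N) =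
      (circSqTo K m n (i + 1) N).comp (rotSq K m) := by
    refine AInfSq_hom_ext fun U U' => AInfSq_hom_ext fun V V' => ?_
    simp only [LinearMap.compr₂_apply, LinearMap.comp_apply, circSqTo_gen, map_smul, rotSq,
      TensorProduct.map_tmul]
    rw [circSqTo_tmul _ _ _ _ _ (rot_mem_piece (gen_mem_piece U')) (gen_mem_piece V),
      rot_circTo_gen hN hi him, rot_circTo_gen hN hi him]
  exact LinearMap.congr_fun₂ h x y

theorem rotSq_circSqTo_last {m n N : ℕ} (hN : N = m + n - 1) {s t : ℤ}
    {x : AInfSq K m} (hx : x ∈ pieceSq K m s) {y : AInfSq K n} (hy : y ∈ pieceSq K n t) :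
    rotSq K N (circSqTo K m n m N x y) =
      (-1 : K) ^ (s * t) • circSqTo K n m 1 N (rotSq K n y) (rotSq K m x) := by
  rw [← sub_eq_zero, ← Submodule.mem_bot K]
  refine pieceSq_induction (f := rotSq K N ∘ₗ circSqTo K m n m N x -
    (-1 : K) ^ (s * t) • (circSqTo K n m 1 N).flip (rotSq K m x) ∘ₗ rotSq K n)
    (fun V V' hV => ?_) hy
  refine pieceSq_induction (f := rotSq K N ∘ₗ (circSqTo K m n m N).flip (gen V ⊗ₜ[K] gen V') -
    (-1 : K) ^ (s * t) • (circSqTo K n m 1 N (rotSq K n (gen V ⊗ₜ[K] gen V'))) ∘ₗ rotSq K m)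
    (fun U U' hU => ?_) hx
  rw [Submodule.mem_bot, LinearMap.sub_apply, sub_eq_zero]
  simp only [LinearMap.comp_apply, LinearMap.smul_apply, LinearMap.flip_apply, circSqTo_gen,
    map_smul, rotSq, TensorProduct.map_tmul]
  rw [circSqTo_tmul _ _ _ _ _ (rot_mem_piece (gen_mem_piece V'))
      (rot_mem_piece (gen_mem_piece U)),
    rot_circTo_last_gen hN, rot_circTo_last_gen hN]
  simp only [TensorProduct.smul_tmul_smul, smul_smul, neg_one_zpow_add]
  congr 1
  apply neg_one_zpow_congr
  rw [← hV, ← hU]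
  push_cast
  generalize (U'.deg : ZMod 2) = a, (V'.deg : ZMod 2) = b, (V.deg : ZMod 2) = c,
    (U.deg : ZMod 2) = d
  decide +revert

theorem diffSq_rotSq {n : ℕ} (x : AInfSq K n) :
    diffSq K n (rotSq K n x) = rotSq K n (diffSq K n x) := by
  suffices h : diffSq K n ∘ₗ rotSq K n = rotSq K n ∘ₗ diffSq K n from LinearMap.congr_fun h x
  refine AInfSq_hom_ext fun U V => ?_
  simp only [LinearMap.comp_apply, rotSq, TensorProduct.map_tmul, diffSq_tmul, map_add, diff_rot,
    signOp_of_mem (rot_mem_piece (gen_mem_piece U)), signOp_gen, map_smul]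

theorem rotSq_pow (n : ℕ) : rotSq K n ^ (n + 1) = 1 := by
  rw [rotSq, TensorProduct.map_pow, rot_pow]
  exact TensorProduct.map_id

end

/-! ### Gaps in the spine of a tree -/

/-- The spine of a tree: the first leaves of the intervals ending in the last leaf, where the whole
interval `{1, …, n}` and the leaf `n` itself are included. -/
def spine (n : ℕ) (l : List Edge) : Set ℕ := {c | c = 1 ∨ c = n ∨ (⟨c, n⟩ : Edge) ∈ l}

/-- `k` and `a` are consecutive elements of `S` which are not consecutive integers. -/
def IsGap (S : Set ℕ) (k a : ℕ) : Prop :=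
  k + 2 ≤ a ∧ k ∈ S ∧ a ∈ S ∧ ∀ c, k < c → c < a → c ∉ S

open Classical in
/-- The edge below the leaves `k, …, a - 1`, for a chosen gap `(k, a)` of the spine. It is compatible
with every tree with this spine, and adding or removing it does not change the spine. If there is no
gap, the value `⟨0, 0⟩` is not an edge of any tree. -/
noncomputable def gapEdge (S : Set ℕ) : Edge :=
  if h : ∃ p : ℕ × ℕ, IsGap S p.1 p.2 then ⟨h.choose.1, h.choose.2 - 1⟩ else ⟨0, 0⟩

theorem gapEdge_spec {S : Set ℕ} (h : ∃ p : ℕ × ℕ, IsGap S p.1 p.2) :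
    ∃ k a, IsGap S k a ∧ gapEdge S = ⟨k, a - 1⟩ :=
  ⟨_, _, h.choose_spec, dif_pos h⟩

theorem spine_perm {n : ℕ} {l l' : List Edge} (h : l.Perm l') : spine n l = spine n l' := by
  ext c
  simp only [spine, Set.mem_ofPred_eq, h.mem_iff]

theorem spine_cons {n : ℕ} {e : Edge} (he : e.last ≠ n) (l : List Edge) :
    spine n (e :: l) = spine n l := by
  ext c
  have : (⟨c, n⟩ : Edge) ≠ e := by
    rintro rfl
    exact he rfl
  simp [spine, this]

theorem spine_subset {n : ℕ} {l : List Edge} (h : IsTreeList n l) {c : ℕ} (hc : c ∈ spine n l) :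
    1 ≤ c ∧ c ≤ n := by
  have := h.two_le
  rcases hc with rfl | rfl | hc
  · omega
  · omega
  · have := h.internal hc
    simp only [Edge.IsInternal] at this
    omega

section Gap

variable {n : ℕ} {l : List Edge}

theorem gapEdge_internal (hl : IsTreeList n l) (h : ∃ p : ℕ × ℕ, IsGap (spine n l) p.1 p.2) :
    (gapEdge (spine n l)).IsInternal n ∧ (gapEdge (spine n l)).last ≠ n := by
  obtain ⟨k, a, ⟨h1, h2, h3, -⟩, h5⟩ := gapEdge_spec h
  have := spine_subset hl h2
  have := spine_subset hl h3
  rw [h5]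
  simp only [Edge.IsInternal]
  omega

theorem gapEdge_indep (hl : IsTreeList n l) (h : ∃ p : ℕ × ℕ, IsGap (spine n l) p.1 p.2) {e : Edge}
    (he : e ∈ l) (hne : e ≠ gapEdge (spine n l)) : (gapEdge (spine n l)).Indep e := by
  refine ⟨hne.symm, ?_⟩
  obtain ⟨k, a, ⟨h1, h2, h3, h4⟩, h5⟩ := gapEdge_spec h
  have hk := spine_subset hl h2
  have ha := spine_subset hl h3
  have hi := hl.internal he
  have hk' : k = 1 ∨ e.Compatible ⟨k, n⟩ := by
    rcases h2 with h | h | h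
    · exact Or.inl h
    · omega
    · exact Or.inr (hl.2.2.2 _ (List.mem_toFinset.2 he) _ (List.mem_toFinset.2 h))
  have ha' : a = n ∨ e.Compatible ⟨a, n⟩ := by
    rcases h3 with h | h | h
    · omega
    · exact Or.inl h
    · exact Or.inr (hl.2.2.2 _ (List.mem_toFinset.2 he) _ (List.mem_toFinset.2 h))
  have hs : e.last = n → ¬(k < e.first ∧ e.first < a) := by
    rintro rfl ⟨h6, h7⟩
    exact h4 _ h6 h7 (Or.inr (Or.inr he))
  rw [h5]
  simp only [Edge.IsInternal, Edge.Compatible] at *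
  omega

theorem exists_gap {c : ℕ} (h1 : 1 ≤ c) (hn : c ≤ n) (hc : c ∉ spine n l) :
    ∃ p : ℕ × ℕ, IsGap (spine n l) p.1 p.2 := by
  classical
  obtain ⟨k, ⟨hk, hkc⟩, hk'⟩ : ∃ k, (k ∈ spine n l ∧ k ≤ c) ∧
      ∀ j, k < j → j ≤ c → j ∉ spine n l := by
    have h := Nat.findGreatest_spec (P := fun k => k ∈ spine n l) h1 (Or.inl rfl)
    refine ⟨_, ⟨h, Nat.findGreatest_le c⟩, fun j h2 h3 => Nat.findGreatest_is_greatest h2 h3⟩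
  have hex : ∃ a, a ∈ spine n l ∧ c ≤ a := ⟨n, Or.inr (Or.inl rfl), hn⟩
  obtain ⟨ha, hac⟩ := Nat.find_spec hex
  have hne : k ≠ c := by rintro rfl; exact hc hk
  have hne' : Nat.find hex ≠ c := by intro h; exact hc (h ▸ ha)
  refine ⟨(k, Nat.find hex), by simp only; omega, hk, ha, fun j hj hj' hm => ?_⟩
  rcases le_total j c with h | h
  · exact hk' j hj h hm
  · exact Nat.find_min hex hj' ⟨hm, h⟩

/-- Only the right comb has a spine without gaps, and it has degree `0`. -/
theorem exists_gap_of_length (h : l.length + 2 < n) :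
    ∃ p : ℕ × ℕ, IsGap (spine n l) p.1 p.2 := by
  by_contra hno
  have hall : ∀ c ∈ Finset.Icc 2 (n - 1), (⟨c, n⟩ : Edge) ∈ l := by
    intro c hc
    rw [Finset.mem_Icc] at hc
    by_contra hcl
    refine hno (exists_gap (n := n) (c := c) (by omega) (by omega) ?_)
    rintro (h | h | h)
    · omega
    · omega
    · exact hcl h
  have hsub : (Finset.Icc 2 (n - 1)).image (fun c => (⟨c, n⟩ : Edge)) ⊆ l.toFinset := by
    intro e he
    obtain ⟨c, hc, rfl⟩ := Finset.mem_image.1 he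
    exact List.mem_toFinset.2 (hall c hc)
  have h1 := Finset.card_le_card hsub
  rw [Finset.card_image_of_injective _ (fun a b hab => (Edge.mk.inj hab).1), Nat.card_Icc] at h1
  have := List.toFinset_card_le l
  omega

end Gap

noncomputable section

variable {K : Type*} [Field K]

/-! ### Acyclicity of the associahedra in positive degrees -/

theorem diff_diff [CharZero K] {n : ℕ} (x : AInf K n) : diff K n (diff K n x) = 0 := by
  suffices h : diff K n ∘ₗ diff K n = 0 from LinearMap.congr_fun h x
  refine AInf_hom_ext fun T => ?_
  rw [LinearMap.comp_apply, diff_gen_sum, map_sum]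
  simp only [diff_oriented]
  set S := ∑ e ∈ internalEdges n, ∑ f ∈ internalEdges n, oriented K n (f :: e :: T.edgeList)
    with hS
  have h : S = -S := by
    conv_lhs => rw [hS, Finset.sum_comm]
    rw [hS, ← Finset.sum_neg_distrib]
    refine Finset.sum_congr rfl fun e _ => ?_
    rw [← Finset.sum_neg_distrib]
    exact Finset.sum_congr rfl fun f _ => oriented_alternating n [] _ _ _
  have h2 : (2 : K) • S = 0 := by
    rw [two_smul]
    nth_rewrite 1 [h]
    exact neg_add_cancel S
  exact (smul_eq_zero.1 h2).resolve_left two_ne_zero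

theorem oriented_perm {n : ℕ} {l l' : List Edge} (h : IsTreeList n l) (hp : l.Perm l') :
    oriented K n l = (orderSign K l * orderSign K l') • oriented K n l' := by
  have h' := h.perm hp
  rw [oriented_of_tree h.1 h.2, oriented_of_tree h'.1 h'.2, smul_smul, mul_assoc,
    orderSign_mul_self, mul_one]
  congr 2
  exact Subtype.ext (List.toFinset_eq_of_perm _ _ hp)

variable (K) in
open Classical in
/-- Contraction of the gap edge, where the gap edge is moved to the front of the orientation. It is a
contracting homotopy for the part of the differential that does not change the spine. -/
def gapContraction (n : ℕ) : AInf K n →ₗ[K] AInf K n :=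
  (treeBasis K n).constr K fun T =>
    if gapEdge (spine n T.edgeList) ∈ T.edgeList then
      orderSign K (gapEdge (spine n T.edgeList) ::
        T.edgeList.erase (gapEdge (spine n T.edgeList))) •
        oriented K n (T.edgeList.erase (gapEdge (spine n T.edgeList)))
    else 0

theorem gapContraction_of_not_mem {n : ℕ} {l : List Edge} (hl : IsTreeList n l)
    (h : gapEdge (spine n l) ∉ l) : gapContraction K n (oriented K n l) = 0 := by
  have hp : l.Perm (PlanarTree.ofFinset l.toFinset hl.2).edgeList := by
    refine (List.perm_ext_iff_of_nodup hl.1 (PlanarTree.nodup_edgeList _)).2 fun e => ?_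
    rw [PlanarTree.mem_edgeList]
    exact List.mem_toFinset.symm
  rw [oriented_of_tree hl.1 hl.2, map_smul, gapContraction, ← treeBasis_apply,
    Module.Basis.constr_basis, if_neg, smul_zero]
  rwa [← spine_perm hp, ← hp.mem_iff]

theorem gapContraction_cons {n : ℕ} {e : Edge} {l : List Edge} (hl : IsTreeList n (e :: l))
    (h : gapEdge (spine n (e :: l)) = e) :
    gapContraction K n (oriented K n (e :: l)) = oriented K n l := by
  have hp : (e :: l).Perm (PlanarTree.ofFinset (e :: l).toFinset hl.2).edgeList := by
    refine (List.perm_ext_iff_of_nodup hl.1 (PlanarTree.nodup_edgeList _)).2 fun e => ?_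
    rw [PlanarTree.mem_edgeList]
    exact List.mem_toFinset.symm
  rw [oriented_of_tree hl.1 hl.2, map_smul, gapContraction, ← treeBasis_apply,
    Module.Basis.constr_basis, ← spine_perm hp, h, if_pos (hp.mem_iff.1 List.mem_cons_self)]
  set m := (PlanarTree.ofFinset (e :: l).toFinset hl.2).edgeList.erase e with hm
  have hp' : l.Perm m := by
    have := hp.erase e
    rwa [List.erase_cons_head] at this
  rw [oriented_perm hl.of_cons hp', smul_smul]
  congr 1
  rw [orderSign, orderSign, hp'.countP_eq]
  have h2 : ((-1 : K) ^ m.countP fun f => decide (f < e)) *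
      (-1) ^ (m.countP fun f => decide (f < e)) = 1 := by
    rw [← pow_add, ← two_mul, pow_mul]
    simp
  linear_combination orderSign K l * orderSign K m * h2

/-- The number of edges ending in the last leaf. -/
def spineLength (n : ℕ) (l : List Edge) : ℕ := l.countP fun e => decide (e.last = n)

variable (K) in
/-- The filtration of the chains of degree `k` by the length of the spine. -/
def spineFiltration (n : ℕ) (k : ℤ) (c : ℕ) : Submodule K (AInf K n) :=
  Submodule.span K {x | ∃ T : PlanarTree n, T.deg = k ∧ c ≤ spineLength n T.edgeList ∧ x = gen T}

theorem oriented_mem_spineFiltration {n : ℕ} {k : ℤ} {c : ℕ} {l : List Edge}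
    (hk : k = (n : ℤ) - 2 - l.length) (hc : c ≤ spineLength n l) :
    oriented K n l ∈ spineFiltration K n k c := by
  by_cases h : IsTreeList n l
  · rw [oriented_of_tree h.1 h.2]
    have hp : l.Perm (PlanarTree.ofFinset l.toFinset h.2).edgeList := by
      refine (List.perm_ext_iff_of_nodup h.1 (PlanarTree.nodup_edgeList _)).2 fun e => ?_
      rw [PlanarTree.mem_edgeList]
      exact List.mem_toFinset.symm
    refine Submodule.smul_mem _ _ (Submodule.subset_span ⟨_, ?_, ?_, rfl⟩)
    · rw [PlanarTree.deg_eq_length, ← hp.length_eq, hk]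
    · rwa [spineLength, ← hp.countP_eq]
  · rw [oriented_of_not h]
    exact Submodule.zero_mem _

theorem exists_gap_of_mem {n : ℕ} {l : List Edge} (hl : IsTreeList n l)
    (h : gapEdge (spine n l) ∈ l) : ∃ p : ℕ × ℕ, IsGap (spine n l) p.1 p.2 := by
  by_contra hno
  have := hl.internal h
  rw [gapEdge, dif_neg hno] at this
  exact absurd this.1 (by simp)

theorem gapContraction_mem {n : ℕ} {k : ℤ} {c : ℕ} {l : List Edge}
    (hk : k = (n : ℤ) - 1 - l.length) (hc : c ≤ spineLength n l) :
    gapContraction K n (oriented K n l) ∈ spineFiltration K n k c := by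
  by_cases hl : IsTreeList n l
  · by_cases h : gapEdge (spine n l) ∈ l
    · have hp := List.perm_cons_erase h
      have hg := gapEdge_internal hl (exists_gap_of_mem hl h)
      rw [oriented_perm hl hp, map_smul,
        gapContraction_cons (hl.perm hp) (by rw [← spine_perm hp])]
      refine Submodule.smul_mem _ _ (oriented_mem_spineFiltration ?_ ?_)
      · rw [hk, hp.length_eq, List.length_cons]
        push_cast
        ring
      · rw [spineLength, hp.countP_eq, List.countP_cons_of_neg (by simpa using hg.2)] at hc
        exact hc
    · rw [gapContraction_of_not_mem hl h]
      exact Submodule.zero_mem _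
  · rw [oriented_of_not hl, map_zero]
    exact Submodule.zero_mem _

theorem spineLength_cons {n : ℕ} {e : Edge} (h : e.last = n) (l : List Edge) :
    spineLength n (e :: l) = spineLength n l + 1 :=
  List.countP_cons_of_pos (by simpa using h)

variable (K) in
/-- The identity minus the boundary of the contraction of gap edges. -/
def spineShift (n : ℕ) : AInf K n →ₗ[K] AInf K n :=
  LinearMap.id - (diff K n ∘ₗ gapContraction K n + gapContraction K n ∘ₗ diff K n)

theorem spineShift_apply {n : ℕ} (x : AInf K n) : spineShift K n x =
    x - (diff K n (gapContraction K n x) + gapContraction K n (diff K n x)) := rfl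

theorem spineShift_cons {n : ℕ} {k : ℤ} {e : Edge} {l : List Edge} (hl : IsTreeList n (e :: l))
    (h : gapEdge (spine n (e :: l)) = e) (hk : k = (n : ℤ) - 3 - l.length) :
    spineShift K n (oriented K n (e :: l)) ∈
      spineFiltration K n k (spineLength n (e :: l) + 1) := by
  have hgap := exists_gap_of_mem hl (by rw [h]; exact List.mem_cons_self)
  have hi := gapEdge_internal hl hgap
  rw [h] at hi
  have hsl : spineLength n (e :: l) = spineLength n l :=
    List.countP_cons_of_neg (by simpa using hi.2)
  rw [spineShift_apply, gapContraction_cons hl h, diff_oriented, diff_oriented, map_sum,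
    ← Finset.sum_add_distrib, ← Finset.add_sum_erase _ _ (mem_internalEdges.2 hi.1),
    oriented_of_not (l := e :: e :: l) (fun h => by simpa using h.1), map_zero, add_zero,
    sub_add_cancel_left]
  refine Submodule.neg_mem _ (Submodule.sum_mem _ fun g hg => ?_)
  rw [Finset.mem_erase, mem_internalEdges] at hg
  by_cases hgn : g.last = n
  · refine Submodule.add_mem _ (oriented_mem_spineFiltration ?_ ?_) (gapContraction_mem ?_ ?_)
    · rw [hk, List.length_cons]
      push_cast
      ring
    · rw [spineLength_cons hgn, hsl]
    · rw [hk, List.length_cons, List.length_cons]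
      push_cast
      ring
    · rw [spineLength_cons hgn]
  · -- Edges outside the spine keep the gap, so that the two terms cancel.
    by_cases ht : IsTreeList n (g :: l)
    · have hs : spine n (g :: l) = spine n (e :: l) := by
        rw [spine_cons hgn, spine_cons hi.2]
      have ht' : IsTreeList n (e :: g :: l) := by
        rw [isTreeList_cons]
        refine ⟨hi.1, fun f hf => ?_, ht⟩
        have := gapEdge_indep ht (hs ▸ hgap) hf
        rw [hs, h] at this
        refine this ?_
        rintro rfl
        rcases List.mem_cons.1 hf with h' | h'
        · exact hg.1 h'.symm
        · exact (List.nodup_cons.1 hl.1).1 h'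
      have h1 : oriented K n (g :: e :: l) = -oriented K n (e :: g :: l) :=
        oriented_alternating n [] g e l
      rw [h1, map_neg, gapContraction_cons ht' (by rw [spine_cons hi.2, hs, h]), add_neg_cancel]
      exact Submodule.zero_mem _
    · have ht' : ¬IsTreeList n (g :: e :: l) := fun h' =>
        ht (h'.perm (List.Perm.swap e g l)).of_cons
      rw [oriented_of_not ht, oriented_of_not ht', map_zero, add_zero]
      exact Submodule.zero_mem _

theorem spineShift_of_not_mem {n : ℕ} {k : ℤ} {l : List Edge} (hl : IsTreeList n l)
    (hgap : ∃ p : ℕ × ℕ, IsGap (spine n l) p.1 p.2)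
    (h : gapEdge (spine n l) ∉ l) (hk : k = (n : ℤ) - 2 - l.length) :
    spineShift K n (oriented K n l) ∈ spineFiltration K n k (spineLength n l + 1) := by
  have hi := gapEdge_internal hl hgap
  set e := gapEdge (spine n l) with he
  have ht : IsTreeList n (e :: l) := by
    rw [isTreeList_cons]
    refine ⟨hi.1, fun f hf => ?_, hl⟩
    exact gapEdge_indep hl hgap hf (by rintro rfl; exact h hf)
  rw [spineShift_apply, gapContraction_of_not_mem hl h, map_zero, zero_add, diff_oriented, map_sum,
    ← Finset.add_sum_erase _ _ (mem_internalEdges.2 hi.1),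
    gapContraction_cons ht (by rw [spine_cons hi.2]), sub_add_cancel_left]
  refine Submodule.neg_mem _ (Submodule.sum_mem _ fun g hg => ?_)
  rw [Finset.mem_erase, mem_internalEdges] at hg
  by_cases hgn : g.last = n
  · refine gapContraction_mem ?_ ?_
    · rw [hk, List.length_cons]
      push_cast
      ring
    · rw [spineLength_cons hgn]
  · by_cases ht : IsTreeList n (g :: l)
    · rw [gapContraction_of_not_mem ht]
      · exact Submodule.zero_mem _
      · rw [spine_cons hgn, ← he, List.mem_cons, not_or]
        exact ⟨hg.1.symm, h⟩
    · rw [oriented_of_not ht, map_zero]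
      exact Submodule.zero_mem _

theorem spineShift_mem {n : ℕ} {k : ℤ} (hk : 0 < k) {c : ℕ} {x : AInf K n}
    (hx : x ∈ spineFiltration K n k c) :
    spineShift K n x ∈ spineFiltration K n k (c + 1) := by
  have hle : spineFiltration K n k c ≤ (spineFiltration K n k (c + 1)).comap (spineShift K n) := by
    rw [spineFiltration, Submodule.span_le]
    rintro _ ⟨T, hT, hc, rfl⟩
    have hmono : spineFiltration K n k (spineLength n T.edgeList + 1) ≤
        spineFiltration K n k (c + 1) :=
      Submodule.span_mono fun x ⟨T', h1, h2, h3⟩ => ⟨T', h1, by omega, h3⟩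
    refine hmono ?_
    have hdeg := T.deg_eq_length
    have hgap := exists_gap_of_length (n := n) (l := T.edgeList) (by omega)
    rw [gen_eq_oriented]
    by_cases h : gapEdge (spine n T.edgeList) ∈ T.edgeList
    · have hp := List.perm_cons_erase h
      have hlen := hp.length_eq
      rw [List.length_cons] at hlen
      rw [oriented_perm T.isTreeList hp, map_smul,
        show spineLength n T.edgeList = spineLength n _ from hp.countP_eq _]
      refine Submodule.smul_mem _ _ (spineShift_cons (T.isTreeList.perm hp) ?_ ?_)
      · rw [← spine_perm hp]
      · omega
    · exact spineShift_of_not_mem T.isTreeList hgap h (by omega)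
  exact hle hx

theorem spineShift_pow_eq_zero {n : ℕ} {k : ℤ} (hk : 0 < k) {x : AInf K n}
    (hx : x ∈ piece K n k) : (spineShift K n ^ n) x = 0 := by
  have h0 : x ∈ spineFiltration K n k 0 :=
    Submodule.span_mono (by
      rintro x ⟨T, h1, h2⟩
      exact ⟨T, h1, Nat.zero_le _, h2⟩) hx
  have h : ∀ j, (spineShift K n ^ j) x ∈ spineFiltration K n k j := by
    intro j
    induction j with
    | zero => exact h0
    | succ j ih =>
      rw [pow_succ', Module.End.mul_apply]
      exact spineShift_mem hk ih
  have hbot : spineFiltration K n k n = ⊥ := by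
    rw [spineFiltration, Submodule.span_eq_bot]
    rintro _ ⟨T, h1, h2, -⟩
    have h3 : spineLength n T.edgeList ≤ T.edgeList.length := List.countP_le_length
    have := T.deg_eq_length
    omega
  have := h n
  rwa [hbot, Submodule.mem_bot] at this

theorem gapContraction_mem_piece {n : ℕ} {k : ℤ} {x : AInf K n} (hx : x ∈ piece K n k) :
    gapContraction K n x ∈ piece K n (k + 1) := by
  refine piece_induction (fun T hT => ?_) hx
  have hle : spineFiltration K n (k + 1) 0 ≤ piece K n (k + 1) :=
    Submodule.span_mono fun x ⟨T', h1, h2, h3⟩ => ⟨T', h1, h3⟩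
  refine hle ?_
  rw [gen_eq_oriented]
  refine gapContraction_mem ?_ (Nat.zero_le _)
  have := T.deg_eq_length
  omega

theorem spineShift_mem_piece {n : ℕ} {k : ℤ} {x : AInf K n} (hx : x ∈ piece K n k) :
    spineShift K n x ∈ piece K n k := by
  have h1 := diff_mem_piece (gapContraction_mem_piece hx)
  have h2 := gapContraction_mem_piece (diff_mem_piece hx)
  rw [add_sub_cancel_right] at h1
  rw [sub_add_cancel] at h2
  exact Submodule.sub_mem _ hx (Submodule.add_mem _ h1 h2)

theorem spineShift_pow_mem_piece {n : ℕ} {k : ℤ} (j : ℕ) {x : AInf K n} (hx : x ∈ piece K n k) :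
    (spineShift K n ^ j) x ∈ piece K n k := by
  induction j with
  | zero => exact hx
  | succ j ih =>
    rw [pow_succ', Module.End.mul_apply]
    exact spineShift_mem_piece ih

section Homotopy

variable [CharZero K]

theorem diff_spineShift_pow {n : ℕ} (j : ℕ) (x : AInf K n) :
    diff K n ((spineShift K n ^ j) x) = (spineShift K n ^ j) (diff K n x) := by
  induction j with
  | zero => rfl
  | succ j ih =>
    rw [pow_succ', Module.End.mul_apply, Module.End.mul_apply, ← ih, spineShift_apply,
      spineShift_apply]
    simp only [map_sub, map_add, diff_diff, map_zero, add_zero, zero_add]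

theorem exists_homotopy (n j : ℕ) : ∃ s : AInf K n →ₗ[K] AInf K n,
    (∀ x, diff K n (s x) + s (diff K n x) = x - (spineShift K n ^ j) x) ∧
      ∀ k, ∀ x ∈ piece K n k, s x ∈ piece K n (k + 1) := by
  induction j with
  | zero => exact ⟨0, by simp, by simp⟩
  | succ j ih =>
    obtain ⟨s, h1, h2⟩ := ih
    refine ⟨gapContraction K n + s ∘ₗ spineShift K n, fun x => ?_, fun k x hx => ?_⟩
    · have h3 := h1 (spineShift K n x)
      have h4 := diff_spineShift_pow 1 x
      rw [pow_one] at h4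
      rw [h4] at h3
      rw [pow_succ, Module.End.mul_apply]
      simp only [LinearMap.add_apply, LinearMap.comp_apply, map_add]
      have h5 : x - (spineShift K n ^ j) (spineShift K n x) =
          (x - spineShift K n x) +
            (spineShift K n x - (spineShift K n ^ j) (spineShift K n x)) := by abel
      rw [h5, ← h3, spineShift_apply]
      abel
    · exact Submodule.add_mem _ (gapContraction_mem_piece hx) (h2 k _ (spineShift_mem_piece hx))

/-- `A∞ ⊗ A∞` has no homology in positive degrees. -/
theorem exists_diffSq_eq {n : ℕ} {k : ℤ} (hk : 0 < k) {x : AInfSq K n} (hx : x ∈ pieceSq K n k)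
    (hd : diffSq K n x = 0) : ∃ z ∈ pieceSq K n (k + 1), diffSq K n z = x := by
  obtain ⟨s, h1, h2⟩ := exists_homotopy (K := K) n n
  set P := spineShift K n ^ n with hP
  -- The homotopy between the identity and `P ⊗ P`.
  set S : AInfSq K n →ₗ[K] AInfSq K n :=
    TensorProduct.map s LinearMap.id + TensorProduct.map (P ∘ₗ signOp K n) s with hS
  have hSt : ∀ u v, S (u ⊗ₜ[K] v) = s u ⊗ₜ[K] v + P (signOp K n u) ⊗ₜ[K] s v := fun u v => rfl
  have key : diffSq K n (S x) + S (diffSq K n x) - x = 0 := by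
    refine pieceSq_induction (f := diffSq K n ∘ₗ S + S ∘ₗ diffSq K n - LinearMap.id) (S := ⊥)
      (fun U V h => ?_) hx
    have hU := gen_mem_piece (K := K) U
    have hV := gen_mem_piece (K := K) V
    have hPP : P (gen U) ⊗ₜ[K] P (gen V) = 0 := by
      by_cases hp : 0 < U.deg
      · rw [hP, spineShift_pow_eq_zero hp hU, TensorProduct.zero_tmul]
      · rw [hP, spineShift_pow_eq_zero (k := V.deg) (by omega) hV, TensorProduct.tmul_zero]
    simp only [LinearMap.sub_apply, LinearMap.add_apply, LinearMap.comp_apply, LinearMap.id_apply,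
      hSt, diffSq_tmul, map_add, signOp_of_mem hU, signOp_of_mem (h2 _ _ hU),
      signOp_of_mem (diff_mem_piece hU), map_smul, hP,
      signOp_of_mem (spineShift_pow_mem_piece n hU), ← TensorProduct.smul_tmul',
      diff_spineShift_pow]
    have hε : (-1 : K) ^ U.deg * (-1) ^ U.deg = 1 := by
      rw [← mul_zpow]
      simp
    have e1 := congrArg (fun y => y ⊗ₜ[K] (gen V : AInf K n)) (h1 (gen U))
    have e2 := congrArg (fun y => P (gen U) ⊗ₜ[K] y) (h1 (gen V))
    simp only [TensorProduct.add_tmul, TensorProduct.tmul_add, TensorProduct.sub_tmul,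
      TensorProduct.tmul_sub, hPP] at e1 e2
    rw [← hP, Submodule.mem_bot, zpow_add₀ (by simp), zpow_sub₀ (by simp), zpow_one]
    simp only [smul_add, smul_smul, hε, mul_neg_one, div_neg, div_one, neg_smul, one_smul]
    linear_combination (norm := skip) e1 + e2
    abel
  rw [hd, map_zero, add_zero, sub_eq_zero] at key
  refine ⟨S x, pieceSq_induction (fun U V h => ?_) hx, key⟩
  have hU := gen_mem_piece (K := K) U
  have hV := gen_mem_piece (K := K) V
  rw [hSt]
  exact Submodule.add_mem _ (tmul_mem_pieceSq (by omega) (h2 _ _ hU) hV)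
    (tmul_mem_pieceSq (by omega) (spineShift_pow_mem_piece n (signOp_mem_piece hU)) (h2 _ _ hV))

end Homotopy

end

/-! ### Post-order of the edges of a tree -/

/-- The order in which a post-order traversal meets the edges of a planar tree: an edge comes after
the edges above it and after the edges to its left. The vertex above the first edge is a corolla. -/
def Edge.PostLE (e f : Edge) : Prop :=
  e.last < f.last ∨ (e.last = f.last ∧ f.first ≤ e.first)

instance : DecidableRel Edge.PostLE := fun e f => by unfold Edge.PostLE; infer_instance

instance : IsTrans Edge Edge.PostLE := ⟨fun e f g h h' => by unfold Edge.PostLE at *; omega⟩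

instance : Std.Antisymm Edge.PostLE := ⟨fun e f h h' => by
  unfold Edge.PostLE at *
  ext <;> omega⟩

instance : Std.Total Edge.PostLE := ⟨fun e f => by unfold Edge.PostLE; omega⟩

/-- The edges of a tree in post-order. -/
def PlanarTree.postList {n : ℕ} (T : PlanarTree n) : List Edge := T.1.sort Edge.PostLE

section PostList

variable {n : ℕ} (T : PlanarTree n)

theorem PlanarTree.nodup_postList : T.postList.Nodup := Finset.sort_nodup _ _

theorem PlanarTree.toFinset_postList : T.postList.toFinset = T.1 := Finset.sort_toFinset _ _

theorem PlanarTree.mem_postList {e : Edge} : e ∈ T.postList ↔ e ∈ T.1 := Finset.mem_sort _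

theorem PlanarTree.pairwise_postList : T.postList.Pairwise Edge.PostLE := Finset.pairwise_sort _ _

theorem PlanarTree.isTreeList_postList : IsTreeList n T.postList :=
  ⟨T.nodup_postList, by rw [T.toFinset_postList]; exact T.2⟩

end PostList

/-- The corolla as a tree. -/
def corollaTree {n : ℕ} (hn : 2 ≤ n) : PlanarTree n :=
  PlanarTree.ofFinset ∅ ⟨hn, by simp, by simp⟩

theorem deg_corollaTree {n : ℕ} (hn : 2 ≤ n) : (corollaTree hn).deg = (n : ℤ) - 2 := by
  simp [corollaTree, PlanarTree.ofFinset, PlanarTree.deg]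

noncomputable section

variable {K : Type*} [Field K]

theorem gen_of_empty {n : ℕ} {T : PlanarTree n} (h : T.1 = ∅) : (gen T : AInf K n) = corolla K n := by
  rw [gen_eq_oriented, corolla, PlanarTree.edgeList, h, Finset.sort_empty]

theorem gen_corollaTree {n : ℕ} (hn : 2 ≤ n) : gen (corollaTree hn) = corolla K n :=
  gen_of_empty rfl

/-! ### Extension from the corollas to all trees -/

/-- The operadic extension of `δ`, which prescribes the values on the corollas, to a tree given by
its edges in post-order: the corolla above the first edge is split off. -/
def diagList (δ : ∀ n, AInfSq K n) : List Edge → ∀ n, AInfSq K n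
  | [], n => δ n
  | e :: l, n =>
    (-1 : K) ^ ((e.first : ℤ) * ((e.last + 1 - e.first : ℕ) + 1) +
        (n + e.first - e.last : ℕ) * ((e.last + 1 - e.first : ℕ) - 2) + l.length) •
      circSqTo K (n + e.first - e.last) (e.last + 1 - e.first) e.first n
        (diagList δ (l.map (Edge.collapse e.first (e.last + 1 - e.first))) (n + e.first - e.last))
        (δ (e.last + 1 - e.first))
  termination_by l => l.length

/-- The operadic extension of `δ`, which prescribes the values on the corollas, to `A∞`. -/
def diagonal (δ : ∀ n, AInfSq K n) (n : ℕ) : AInf K n →ₗ[K] AInfSq K n :=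
  (treeBasis K n).constr K fun T => orderSign K T.postList • diagList δ T.postList n

theorem diagList_cons (δ : ∀ n, AInfSq K n) (l : List Edge) {m k j N : ℕ} (hN : N = m + k - 1)
    (hk : 2 ≤ k) :
    diagList δ (⟨j, j + k - 1⟩ :: l.map (Edge.outer j k)) N =
      (-1 : K) ^ ((j : ℤ) * (k + 1) + m * (k - 2) + l.length) •
        circSqTo K m k j N (diagList δ l m) (δ k) := by
  have h1 : N + j - (j + k - 1) = m := by omega
  have h2 : j + k - 1 + 1 - j = k := by omega
  rw [diagList]
  simp only [List.length_map, List.map_map]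
  rw [h1, h2]
  have h3 : Edge.collapse j k ∘ Edge.outer j k = id :=
    funext fun e => Edge.collapse_outer (by omega)
  rw [h3, List.map_id]

variable {δ : ∀ n, AInfSq K n}

theorem diagonal_oriented {n : ℕ} {l : List Edge} (hl : IsTreeList n l)
    (hs : l.Pairwise Edge.PostLE) : diagonal δ n (oriented K n l) = diagList δ l n := by
  have hp : (PlanarTree.ofFinset l.toFinset hl.2).postList = l :=
    (List.toFinset_sort Edge.PostLE hl.1).2 hs
  rw [oriented_of_tree hl.1 hl.2, map_smul, diagonal, ← treeBasis_apply,
    Module.Basis.constr_basis, hp, smul_smul, orderSign_mul_self, one_smul]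

theorem isTreeList_nil {n : ℕ} (hn : 2 ≤ n) : IsTreeList n [] := by
  simp [isTreeList_iff, hn]

theorem diagonal_corolla {n : ℕ} (hn : 2 ≤ n) : diagonal δ n (corolla K n) = δ n := by
  rw [corolla, diagonal_oriented (isTreeList_nil hn) List.Pairwise.nil, diagList]

variable (K) in
/-- The span of the trees all of whose edges have the last leaf `j` or a later one. If a corolla is
grafted to the leaf `j` of such a tree, the new edge is the first one in post-order. -/
def lastGE (m j : ℕ) : Submodule K (AInf K m) :=
  Submodule.span K {x | ∃ U : PlanarTree m, (∀ e ∈ U.1, j ≤ e.last) ∧ x = gen U}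

theorem gen_mem_lastGE {m j : ℕ} {U : PlanarTree m} (h : ∀ e ∈ U.1, j ≤ e.last) :
    gen U ∈ lastGE K m j :=
  Submodule.subset_span ⟨U, h, rfl⟩

theorem oriented_mem_lastGE {m j : ℕ} {l : List Edge} (h : ∀ e ∈ l, j ≤ e.last) :
    oriented K m l ∈ lastGE K m j := by
  by_cases hl : IsTreeList m l
  · rw [oriented_of_tree hl.1 hl.2]
    exact Submodule.smul_mem _ _ (gen_mem_lastGE fun e he => h e (List.mem_toFinset.1 he))
  · rw [oriented_of_not hl]
    exact Submodule.zero_mem _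

theorem circTo_corolla {m k j N : ℕ} (hN : N = m + k - 1) (hj : 1 ≤ j) (hjm : j ≤ m)
    {l : List Edge} (hl : ∀ e ∈ l, e.IsInternal m) :
    circTo K m k j N (oriented K m l) (corolla K k) =
      (-1 : K) ^ ((j : ℤ) * (k + 1) + m * (k - 2) + l.length) •
        oriented K N (⟨j, j + k - 1⟩ :: l.map (Edge.outer j k)) := by
  have h := (oriented_alternating (K := K) N).move (K := K) ⟨j, j + k - 1⟩ []
    (l.map (Edge.outer j k)) []
  simp only [List.nil_append, List.append_nil, List.length_map] at h
  rw [corolla, circTo_oriented hN hj hjm hl (by simp), h, smul_smul, ← zpow_natCast,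
    neg_one_zpow_add]
  simp only [List.map_nil, List.append_nil, List.length_nil, Nat.cast_zero, sub_zero]
  congr 1
  apply neg_one_zpow_congr
  push_cast
  generalize (j : ZMod 2) = j, (m : ZMod 2) = m, (k : ZMod 2) = k, (l.length : ZMod 2) = a
  decide +revert

theorem graft_isTreeList {m k j N : ℕ} (hN : N = m + k - 1) (hj : 1 ≤ j) (hjm : j ≤ m)
    {l : List Edge} (hl : ∀ e ∈ l, e.IsInternal m) :
    IsTreeList N (⟨j, j + k - 1⟩ :: l.map (Edge.outer j k)) ↔ IsTreeList m l ∧ 2 ≤ k := by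
  have h := isTreeList_graft_iff hN hj hjm (l' := []) hl (by simp)
  have hp : (l.map (Edge.outer j k) ++ [].map (Edge.inner j) ++ [(⟨j, j + k - 1⟩ : Edge)]).Perm
      (⟨j, j + k - 1⟩ :: l.map (Edge.outer j k)) := by
    simp
  have h2 : IsTreeList k [] ↔ 2 ≤ k := ⟨fun h => h.two_le, isTreeList_nil⟩
  rw [h2] at h
  exact ⟨fun h' => h.1 (h'.perm hp.symm), fun h' => (h.2 h').perm hp⟩

theorem diagonal_circTo_corolla {m k j N : ℕ} (hN : N = m + k - 1) (hj : 1 ≤ j) (hjm : j ≤ m)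
    (hk : 2 ≤ k) {x : AInf K m} (hx : x ∈ lastGE K m j) :
    diagonal δ N (circTo K m k j N x (corolla K k)) =
      circSqTo K m k j N (diagonal δ m x) (δ k) := by
  induction hx using Submodule.span_induction with
  | zero => simp
  | add x x' _ _ h h' => simp only [map_add, LinearMap.add_apply, h, h']
  | smul c x _ h => simp only [map_smul, LinearMap.smul_apply, h]
  | mem x h =>
    obtain ⟨U, hU, rfl⟩ := h
    have hl := U.isTreeList_postList
    rw [gen_eq_smul_oriented U.nodup_postList U.toFinset_postList, map_smul, map_smul,
      LinearMap.smul_apply, map_smul, map_smul, LinearMap.smul_apply,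
      circTo_corolla hN hj hjm fun e he => hl.internal he, map_smul, diagonal_oriented,
      diagList_cons δ _ hN hk, smul_smul (_ ^ _), ← mul_zpow, diagonal_oriented hl]
    · simp
    · exact U.pairwise_postList
    · exact (graft_isTreeList hN hj hjm fun e he => hl.internal he).2 ⟨hl, hk⟩
    · rw [List.pairwise_cons, List.pairwise_map]
      constructor
      · intro f hf
        obtain ⟨e, he, rfl⟩ := List.mem_map.1 hf
        have h1 := hl.internal he
        have h2 := hU e ((U.mem_postList).1 he)
        simp only [Edge.IsInternal] at h1
        unfold Edge.PostLE
        grind [Edge.outer]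
      · refine U.pairwise_postList.imp fun {e f} h => ?_
        unfold Edge.PostLE at *
        grind [Edge.outer]

/-- Every tree with an edge arises from a smaller tree by grafting a corolla, in such a way that the
new edge is the first one in post-order. -/
theorem exists_eq_circTo_corolla {n : ℕ} (T : PlanarTree n) (hT : T.1 ≠ ∅) :
    ∃ (m k j : ℕ) (U : PlanarTree m) (s : K), 1 ≤ j ∧ j ≤ m ∧ 2 ≤ m ∧ 2 ≤ k ∧ m < n ∧ k < n ∧
      n = m + k - 1 ∧ gen T = s • circTo K m k j n (gen U) (corolla K k) ∧
      (∀ e ∈ U.1, j ≤ e.last) ∧ (∀ e ∈ T.1, j + k - 1 ≤ e.last) ∧ U.deg + (k - 2) = T.deg := by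
  have hl := T.isTreeList_postList
  have hpw := T.pairwise_postList
  have hfin := T.toFinset_postList
  have hmem : ∀ e, e ∈ T.1 → e ∈ T.postList := fun e => T.mem_postList.2
  have hgen := gen_eq_smul_oriented (K := K) T.nodup_postList T.toFinset_postList
  have hcard : T.1.card = T.postList.length := by
    rw [PlanarTree.postList, Finset.length_sort]
  cases hlist : T.postList with
  | nil =>
    rw [hlist] at hfin
    exact absurd hfin.symm hT
  | cons e l =>
    rw [hlist] at hl hpw hgen hcard hmem
    have hn := hl.two_le
    have hei := hl.internal List.mem_cons_self
    obtain ⟨a, b⟩ := e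
    simp only [Edge.IsInternal] at hei
    obtain ⟨k, rfl⟩ : ∃ k, b = a + k - 1 := ⟨b + 1 - a, by omega⟩
    obtain ⟨m, hm⟩ : ∃ m, m = n + 1 - k := ⟨_, rfl⟩
    rw [List.pairwise_cons] at hpw
    rw [isTreeList_cons] at hl
    have hN : n = m + k - 1 := by omega
    have ho : ∀ e ∈ l, (e.collapse a k).outer a k = e ∧ (e.collapse a k).IsInternal m := by
      intro e he
      refine Edge.outer_collapse hN (by omega) (by omega) (by omega) (hl.2.2.internal he)
        (hl.2.1 e he).symm ?_
      have h1 := hpw.1 e he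
      have h2 := (hl.2.1 e he).1
      rintro ⟨h3, h4⟩
      unfold Edge.PostLE at h1
      refine h2 (Edge.ext ?_ ?_) <;> simp only at * <;> omega
    have hmap : (l.map (Edge.collapse a k)).map (Edge.outer a k) = l := by
      rw [List.map_map]
      conv_rhs => rw [← List.map_id l]
      exact List.map_congr_left fun e he => (ho e he).1
    have hint : ∀ e ∈ l.map (Edge.collapse a k), e.IsInternal m := by
      intro e he
      obtain ⟨f, hf, rfl⟩ := List.mem_map.1 he
      exact (ho f hf).2
    have htree : IsTreeList m (l.map (Edge.collapse a k)) := by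
      refine ((graft_isTreeList hN (j := a) (by omega) (by omega) hint).1 ?_).1
      rw [hmap, isTreeList_cons]
      exact hl
    refine ⟨m, k, a, PlanarTree.ofFinset _ htree.2, ?_⟩
    have h1 := circTo_corolla (K := K) hN (j := a) (by omega) (by omega) hint
    rw [hmap, oriented_of_tree htree.1 htree.2, map_smul, LinearMap.smul_apply] at h1
    have h2 := congrArg (fun y => orderSign K (⟨a, a + k - 1⟩ :: l) • ((-1 : K) ^ ((a : ℤ) * (k + 1) +
      m * (k - 2) + (l.map (Edge.collapse a k)).length)) • y) h1
    beta_reduce at h2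
    rw [smul_smul ((-1 : K) ^ _) ((-1 : K) ^ _), ← mul_zpow, mul_neg_one, neg_neg, one_zpow,
      one_smul, ← hgen, smul_smul, smul_smul] at h2
    refine ⟨_, by omega, by omega, by omega, by omega, by omega, by omega, hN, h2.symm, ?_, ?_, ?_⟩
    · intro e he
      obtain ⟨f, hf, rfl⟩ := List.mem_map.1 (List.mem_toFinset.1 he)
      have := hpw.1 f hf
      unfold Edge.PostLE at this
      grind [Edge.collapse]
    · intro e he
      rcases List.mem_cons.1 (hmem e he) with rfl | h
      · exact le_rfl
      · have := hpw.1 e h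
        unfold Edge.PostLE at this
        simp only at this
        omega
    · have h3 : (PlanarTree.ofFinset _ htree.2).1.card = l.length := by
        rw [← List.length_map (f := Edge.collapse a k) (as := l)]
        exact List.toFinset_card_of_nodup htree.1
      rw [PlanarTree.deg, PlanarTree.deg, h3, hcard, List.length_cons]
      push_cast
      omega

theorem corolla_mem_piece (n : ℕ) : corolla K n ∈ piece K n (n - 2) :=
  oriented_mem (by simp)

theorem diagonal_gen_mem (hδ : ∀ n : ℕ, δ n ∈ pieceSq K n (n - 2)) :
    ∀ (n : ℕ) (T : PlanarTree n), diagonal δ n (gen T) ∈ pieceSq K n T.deg := by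
  intro n
  induction n using Nat.strong_induction_on with
  | _ n ih =>
    intro T
    by_cases hT : T.1 = ∅
    · rw [gen_of_empty hT, diagonal_corolla T.two_le, PlanarTree.deg, hT]
      simpa using hδ n
    · obtain ⟨m, k, j, U, s, hj, hjm, hm, hk, hmn, hkn, hn, hT', hU, -, hdeg⟩ :=
        exists_eq_circTo_corolla (K := K) T hT
      rw [hT', map_smul, diagonal_circTo_corolla hn hj hjm hk (gen_mem_lastGE hU), ← hdeg]
      exact Submodule.smul_mem _ _ (circSqTo_mem_pieceSq hn (ih m hmn U) (hδ k))

theorem diagonal_mem (hδ : ∀ n : ℕ, δ n ∈ pieceSq K n (n - 2)) {n : ℕ} {k : ℤ} {x : AInf K n}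
    (hx : x ∈ piece K n k) : diagonal δ n x ∈ pieceSq K n k :=
  piece_induction (fun T hT => hT ▸ diagonal_gen_mem hδ n T) hx

theorem circTo_mem_lastGE {m n i N j : ℕ} (U : PlanarTree m) (V : PlanarTree n)
    (hU : ∀ e ∈ U.1, j ≤ (e.outer i n).last) (hV : ∀ e ∈ V.1, j ≤ (e.inner i).last)
    (hj : j ≤ i + n - 1) : circTo K m n i N (gen U) (gen V) ∈ lastGE K N j := by
  rw [circTo_gen]
  refine Submodule.smul_mem _ _ (oriented_mem_lastGE fun e he => ?_)
  simp only [List.mem_append, List.mem_map, List.mem_singleton, PlanarTree.mem_edgeList] at he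
  rcases he with (⟨e, he, rfl⟩ | ⟨e, he, rfl⟩) | rfl
  · exact hU e he
  · exact hV e he
  · exact hj

/-- The extension is compatible with all compositions. In the inductive step, the first edge of the
composite in post-order lies in the lower tree, to the left of the grafting edge, or in the upper
tree, or it is the grafting edge. -/
theorem diagonal_circTo (hδ : ∀ n : ℕ, δ n ∈ pieceSq K n (n - 2)) (N : ℕ) :
    ∀ {m n i : ℕ}, N = m + n - 1 → 1 ≤ i → i ≤ m → ∀ (x : AInf K m) (y : AInf K n),
      diagonal δ N (circTo K m n i N x y) =
        circSqTo K m n i N (diagonal δ m x) (diagonal δ n y) := by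
  induction N using Nat.strong_induction_on with
  | _ N ih =>
    intro m n i hN hi him x y
    have h : (circTo K m n i N).compr₂ (diagonal δ N) =
        (circSqTo K m n i N).compl₁₂ (diagonal δ m) (diagonal δ n) := by
      refine AInf_hom_ext fun U => AInf_hom_ext fun V => ?_
      rw [LinearMap.compr₂_apply, LinearMap.compl₁₂_apply]
      have hVn := V.two_le
      by_cases hU : ∀ e ∈ U.1, i ≤ e.last
      · by_cases hV : V.1 = ∅
        · rw [gen_of_empty hV, diagonal_circTo_corolla hN hi him hVn (gen_mem_lastGE hU),
            diagonal_corolla hVn]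
        · obtain ⟨n', k, j, V', s, hj, hjn, hn', hk, hmn, hkn, hn, hV', hVl, -, -⟩ :=
            exists_eq_circTo_corolla (K := K) V hV
          have hM : m + n' - 1 = m + n' - 1 := rfl
          have hN' : N = m + n' - 1 + k - 1 := by omega
          have h1 := circTo_assoc_gen (K := K) hM hn hN' hi him hj hjn U V' (corollaTree hk)
          rw [gen_corollaTree] at h1
          rw [hV', map_smul, map_smul, map_smul, ← h1, diagonal_circTo_corolla hN' (by omega)
            (by omega) hk, ih _ (by omega) hM hi him, map_smul,
            diagonal_circTo_corolla hn hj hjn hk (gen_mem_lastGE hVl),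
            circSqTo_assoc hM hn hN' hi him hj hjn]
          refine circTo_mem_lastGE U V' (fun e he => ?_) (fun e he => ?_) (by omega)
          · have := hU e he
            grind [Edge.outer]
          · have := hVl e he
            grind [Edge.inner]
      · push Not at hU
        obtain ⟨e, heU, hei⟩ := hU
        obtain ⟨m', k, j, U', s, hj, hjm, hm', hk, hmm, hkm, hm, hU', hUl, hUj, -⟩ :=
          exists_eq_circTo_corolla (K := K) U (Finset.ne_empty_of_mem heU)
        have hlast := hUj e heU
        obtain ⟨i', rfl⟩ : ∃ i', i = i' + k - 1 := ⟨i + 1 - k, by omega⟩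
        have hM' : m' + n - 1 = m' + n - 1 := rfl
        have hN' : N = m' + n - 1 + k - 1 := by omega
        have h1 := circTo_comm_gen (K := K) hm hM' hN hj (k := i') (by omega) (by omega) U'
          (corollaTree hk) V
        have h2 := circSqTo_comm hm hM' hN hj (k := i') (by omega) (by omega) (diagonal δ m' (gen U'))
          (hδ k) (diagonal_gen_mem hδ n V)
        rw [gen_corollaTree, deg_corollaTree] at h1
        rw [hU', map_smul, map_smul, LinearMap.smul_apply, map_smul, map_smul,
          LinearMap.smul_apply, h1, map_smul, diagonal_circTo_corolla hN' hj (by omega) hk,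
          ih _ (by omega) hM' (by omega) (by omega),
          diagonal_circTo_corolla hm hj hjm hk (gen_mem_lastGE hUl), h2]
        refine circTo_mem_lastGE U' V (fun e he => ?_) (fun e he => ?_) (by omega)
        · have := hUl e he
          grind [Edge.outer]
        · have := V.2.2.1 e he
          simp only [Edge.IsInternal] at this
          grind [Edge.inner]
    exact LinearMap.congr_fun₂ h x y

/-! ### Compatibility with the differential and the rotation -/

theorem diagonal_diff_gen [CharZero K] (hδ : ∀ n : ℕ, δ n ∈ pieceSq K n (n - 2)) {n : ℕ}
    (h : ∀ k < n, ∀ x, diagonal δ k (diff K k x) = diffSq K k (diagonal δ k x))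
    (T : PlanarTree n) (hT : T.1 ≠ ∅) :
    diagonal δ n (diff K n (gen T)) = diffSq K n (diagonal δ n (gen T)) := by
  obtain ⟨m, k, j, U, s, hj, hjm, hm, hk, hmn, hkn, hn, hT', -⟩ :=
    exists_eq_circTo_corolla (K := K) T hT
  rw [hT', map_smul, map_smul, map_smul, map_smul, diff_circTo hn hj hjm, map_add,
    diagonal_circTo hδ n hn hj hjm, diagonal_circTo hδ n hn hj hjm,
    diagonal_circTo hδ n hn hj hjm, diffSq_circSqTo hn hj hjm, h m hmn, h k hkn,
    signOp_map_of_mem (diagonal_gen_mem hδ m U), signOp_gen, map_smul]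

theorem rot_corolla (n : ℕ) : rot K n (corolla K n) = (-1 : K) ^ n • corolla K n := by
  rw [corolla, rot_oriented (by simp), List.map_nil]

theorem diagonal_rot_gen (hδ : ∀ n : ℕ, δ n ∈ pieceSq K n (n - 2)) {n : ℕ}
    (h : ∀ k < n, ∀ x, diagonal δ k (rot K k x) = rotSq K k (diagonal δ k x))
    (T : PlanarTree n) (hT : T.1 ≠ ∅) :
    diagonal δ n (rot K n (gen T)) = rotSq K n (diagonal δ n (gen T)) := by
  obtain ⟨m, k, j, U, s, hj, hjm, hm, hk, hmn, hkn, hn, hT', -⟩ :=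
    exists_eq_circTo_corolla (K := K) T hT
  rw [hT', map_smul, map_smul, map_smul, map_smul, diagonal_circTo hδ n hn hj hjm]
  congr 1
  rw [← gen_corollaTree hk]
  rcases hjm.lt_or_eq with hjm' | rfl
  · rw [rot_circTo_gen hn hj hjm', diagonal_circTo hδ n hn (by omega) (by omega), h m hmn,
      rotSq_circSqTo hn hj hjm']
  · rw [rot_circTo_last_gen hn, map_smul, diagonal_circTo hδ n (by omega) le_rfl (by omega),
      h j hmn, h k hkn,
      rotSq_circSqTo_last hn (diagonal_gen_mem hδ j U) (diagonal_gen_mem hδ k (corollaTree hk))]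

theorem diagonal_congr_gen {δ' : ∀ n, AInfSq K n} {n : ℕ} (h : ∀ k < n, δ k = δ' k)
    (T : PlanarTree n) (hT : T.1 ≠ ∅) : diagonal δ n (gen T) = diagonal δ' n (gen T) := by
  induction n using Nat.strong_induction_on with
  | _ n ih =>
    obtain ⟨m, k, j, U, s, hj, hjm, hm, hk, hmn, hkn, hn, hT', hU, -⟩ :=
      exists_eq_circTo_corolla (K := K) T hT
    rw [hT', map_smul, map_smul, diagonal_circTo_corolla hn hj hjm hk (gen_mem_lastGE hU),
      diagonal_circTo_corolla hn hj hjm hk (gen_mem_lastGE hU), h k hkn]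
    by_cases hU' : U.1 = ∅
    · rw [gen_of_empty hU', diagonal_corolla hm, diagonal_corolla hm, h m hmn]
    · rw [ih m hmn (fun k hk => h k (hk.trans hmn)) U hU']

/-- The boundary of the corolla only involves trees with an edge. -/
theorem eq_on_diff_corolla {n : ℕ} {W : Type*} [AddCommGroup W] [Module K W]
    {f g : AInf K n →ₗ[K] W} (h : ∀ T : PlanarTree n, T.1 ≠ ∅ → f (gen T) = g (gen T)) :
    f (diff K n (corolla K n)) = g (diff K n (corolla K n)) := by
  rw [corolla, diff_oriented, map_sum, map_sum]
  refine Finset.sum_congr rfl fun e _ => ?_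
  by_cases he : IsTreeList n [e]
  · rw [oriented_of_tree he.1 he.2, map_smul, map_smul, h]
    simp [PlanarTree.ofFinset]
  · rw [oriented_of_not he, map_zero, map_zero]

/-! ### The values on the corollas -/

/-- The conditions on the value `δ n` at the corolla which make the extension of `δ` a chain map and
compatible with the rotation; on the corolla with two leaves the value is prescribed. -/
structure IsCorollaValue (δ : ∀ n, AInfSq K n) (n : ℕ) : Prop where
  diff_eq : diffSq K n (δ n) = diagonal δ n (diff K n (corolla K n))
  rot_eq : rotSq K n (δ n) = (-1 : K) ^ n • δ n
  two : n = 2 → δ n = corolla K n ⊗ₜ[K] corolla K n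

variable {δ : ∀ n, AInfSq K n}

theorem diagonal_diff [CharZero K] (hδ : ∀ n : ℕ, δ n ∈ pieceSq K n (n - 2)) {N : ℕ}
    (h : ∀ n < N, IsCorollaValue δ n) :
    ∀ n < N, ∀ x, diagonal δ n (diff K n x) = diffSq K n (diagonal δ n x) := by
  intro n
  induction n using Nat.strong_induction_on with
  | _ n ih =>
    intro hn x
    suffices h : diagonal δ n ∘ₗ diff K n = diffSq K n ∘ₗ diagonal δ n from LinearMap.congr_fun h x
    refine AInf_hom_ext fun T => ?_
    by_cases hT : T.1 = ∅
    · rw [LinearMap.comp_apply, LinearMap.comp_apply, gen_of_empty hT, diagonal_corolla T.two_le,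
        (h n hn).diff_eq]
    · exact diagonal_diff_gen hδ (fun k hk => ih k hk (hk.trans hn)) T hT

theorem diagonal_rot (hδ : ∀ n : ℕ, δ n ∈ pieceSq K n (n - 2)) {N : ℕ}
    (h : ∀ n < N, IsCorollaValue δ n) :
    ∀ n < N, ∀ x, diagonal δ n (rot K n x) = rotSq K n (diagonal δ n x) := by
  intro n
  induction n using Nat.strong_induction_on with
  | _ n ih =>
    intro hn x
    suffices h : diagonal δ n ∘ₗ rot K n = rotSq K n ∘ₗ diagonal δ n from LinearMap.congr_fun h x
    refine AInf_hom_ext fun T => ?_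
    by_cases hT : T.1 = ∅
    · rw [LinearMap.comp_apply, LinearMap.comp_apply, gen_of_empty hT, rot_corolla, map_smul,
        diagonal_corolla T.two_le, (h n hn).rot_eq]
    · exact diagonal_rot_gen hδ (fun k hk => ih k hk (hk.trans hn)) T hT

theorem IsCorollaValue.congr {δ' : ∀ n, AInfSq K n} {n : ℕ} (h : ∀ k ≤ n, δ k = δ' k)
    (hδ : IsCorollaValue δ n) : IsCorollaValue δ' n := by
  refine ⟨?_, ?_, ?_⟩
  · rw [← h n le_rfl, hδ.diff_eq]
    exact eq_on_diff_corolla fun T hT => diagonal_congr_gen (fun k hk => h k hk.le) T hT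
  · rw [← h n le_rfl, hδ.rot_eq]
  · rw [← h n le_rfl]
    exact hδ.two

/-- A bounding chain of a chain which the rotation multiplies by `(-1)^n` can be averaged over the
cyclic group, so that the rotation multiplies it by the same sign. -/
theorem exists_rotSq_eq [CharZero K] {n : ℕ} {k : ℤ} {z : AInfSq K n} (hz : z ∈ pieceSq K n k)
    (hw : rotSq K n (diffSq K n z) = (-1 : K) ^ n • diffSq K n z) :
    ∃ z' ∈ pieceSq K n k, diffSq K n z' = diffSq K n z ∧ rotSq K n z' = (-1 : K) ^ n • z' := by
  set Q : Module.End K (AInfSq K n) := (-1 : K) ^ n • rotSq K n with hQ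
  have hε : (-1 : K) ^ n * (-1) ^ n = 1 := by rw [← mul_pow]; simp
  have hQn : Q ^ (n + 1) = 1 := by
    rw [hQ, smul_pow, rotSq_pow, ← pow_mul, (Nat.even_mul_succ_self n).neg_one_pow, one_smul]
  have hQm : ∀ j, (Q ^ j) z ∈ pieceSq K n k := by
    intro j
    induction j with
    | zero => exact hz
    | succ j ih =>
      rw [pow_succ', Module.End.mul_apply]
      exact Submodule.smul_mem _ _ (rotSq_mem_pieceSq ih)
  have hQd : ∀ j, diffSq K n ((Q ^ j) z) = diffSq K n z := by
    intro j
    induction j with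
    | zero => rfl
    | succ j ih =>
      rw [pow_succ', Module.End.mul_apply, hQ, LinearMap.smul_apply, map_smul, diffSq_rotSq, ← hQ,
        ih, hw, smul_smul, hε, one_smul]
  have hn : (n + 1 : K) ≠ 0 := by exact_mod_cast Nat.succ_ne_zero n
  have hfix : Q (∑ j ∈ Finset.range (n + 1), (Q ^ j) z) = ∑ j ∈ Finset.range (n + 1), (Q ^ j) z := by
    have h1 := Finset.sum_range_succ' (fun j => (Q ^ j) z) (n + 1)
    rw [Finset.sum_range_succ, hQn, pow_zero] at h1
    rw [map_sum]
    simp only [← Module.End.mul_apply, ← pow_succ']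
    exact (add_right_cancel h1).symm
  refine ⟨(n + 1 : K)⁻¹ • ∑ j ∈ Finset.range (n + 1), (Q ^ j) z, ?_, ?_, ?_⟩
  · exact Submodule.smul_mem _ _ (Submodule.sum_mem _ fun j _ => hQm j)
  · rw [map_smul, map_sum, Finset.sum_congr rfl fun j _ => hQd j, Finset.sum_const,
      Finset.card_range, ← Nat.cast_smul_eq_nsmul K, smul_smul]
    push_cast
    rw [inv_mul_cancel₀ hn, one_smul]
  · have h2 : ∀ y, rotSq K n y = (-1 : K) ^ n • Q y := by
      intro y
      rw [hQ, LinearMap.smul_apply, smul_smul, hε, one_smul]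
    rw [h2, map_smul, hfix]

theorem diff_corolla_two : diff K 2 (corolla K 2) = 0 := by
  rw [corolla, diff_oriented]
  exact Finset.sum_eq_zero fun e he => by
    have := mem_internalEdges.1 he
    simp only [Edge.IsInternal] at this
    omega

theorem internalEdges_three : internalEdges 3 = {⟨1, 2⟩, ⟨2, 3⟩} := by
  ext ⟨a, b⟩
  simp only [mem_internalEdges, Edge.IsInternal, Finset.mem_insert, Finset.mem_singleton,
    Edge.mk.injEq]
  omega

theorem circTo_corolla_two (i N : ℕ) (hi : 1 ≤ i) (hi2 : i ≤ 2) (hN : N = 3) :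
    circTo K 2 2 i N (corolla K 2) (corolla K 2) = (-1 : K) ^ i • oriented K N [⟨i, i + 1⟩] := by
  have h := circTo_corolla (K := K) (m := 2) (k := 2) (N := N) (by omega) hi hi2 (l := []) (by simp)
  rw [← corolla] at h
  rw [h, ← zpow_natCast]
  congr 1
  apply neg_one_zpow_congr
  push_cast
  generalize (i : ZMod 2) = j
  simp only [List.length_nil, Nat.cast_zero]
  decide +revert

theorem diff_corolla_three : diff K 3 (corolla K 3) =
    circTo K 2 2 2 3 (corolla K 2) (corolla K 2) - circTo K 2 2 1 3 (corolla K 2) (corolla K 2) := by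
  rw [circTo_corolla_two 2 3 (by omega) le_rfl rfl, circTo_corolla_two 1 3 le_rfl (by omega) rfl,
    corolla, diff_oriented, internalEdges_three, Finset.sum_pair (by simp)]
  simp
  abel

theorem corolla_two_mem : corolla K 2 ∈ piece K 2 0 := by
  simpa using corolla_mem_piece (K := K) 2

/-- The product of `c₂` with itself, as a chain on `K(3)`, is a cycle of degree `0`. -/
theorem diff_circTo_corolla_two {i : ℕ} (hi : 1 ≤ i) (hi2 : i ≤ 2) :
    diff K 3 (circTo K 2 2 i 3 (corolla K 2) (corolla K 2)) = 0 := by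
  rw [diff_circTo (m := 2) (n := 2) (N := 3) rfl hi hi2, diff_corolla_two, map_zero, LinearMap.zero_apply, map_zero, add_zero]

/-- The boundary of the corolla is mapped to a boundary. For three leaves, the boundary of `c₃` is
`y - x`, with `x` and `y` the two products of three factors, and `y ⊗ y - x ⊗ x` bounds
`c₃ ⊗ y + x ⊗ c₃`. For more leaves, the degree is positive and the acyclicity applies. -/
theorem exists_diffSq_eq_diagonal [CharZero K] (hδ : ∀ n : ℕ, δ n ∈ pieceSq K n (n - 2)) {n : ℕ}
    (hn : 3 ≤ n) (h : ∀ k < n, IsCorollaValue δ k) :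
    ∃ z ∈ pieceSq K n (n - 2), diffSq K n z = diagonal δ n (diff K n (corolla K n)) := by
  rcases hn.eq_or_lt with rfl | hn'
  · have h2 := (h 2 (by omega)).two rfl
    have hc : ∀ i, 1 ≤ i → i ≤ 2 → diagonal δ 3 (circTo K 2 2 i 3 (corolla K 2) (corolla K 2)) =
        circTo K 2 2 i 3 (corolla K 2) (corolla K 2) ⊗ₜ[K]
          circTo K 2 2 i 3 (corolla K 2) (corolla K 2) := by
      intro i hi hi2
      rw [diagonal_circTo hδ 3 rfl hi hi2, diagonal_corolla le_rfl, h2,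
        circSqTo_tmul _ _ _ _ _ corolla_two_mem corolla_two_mem]
      simp
    have hm : ∀ i, circTo K 2 2 i 3 (corolla K 2) (corolla K 2) ∈ piece K 3 0 := fun i => by
      simpa using circTo_mem_piece (i := i) (N := 3) rfl (corolla_two_mem (K := K)) corolla_two_mem
    refine ⟨corolla K 3 ⊗ₜ[K] circTo K 2 2 2 3 (corolla K 2) (corolla K 2) +
      circTo K 2 2 1 3 (corolla K 2) (corolla K 2) ⊗ₜ[K] corolla K 3, ?_, ?_⟩
    · exact Submodule.add_mem _
        (tmul_mem_pieceSq (by norm_num) (corolla_mem_piece 3) (hm 2))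
        (tmul_mem_pieceSq (by norm_num) (hm 1) (corolla_mem_piece 3))
    · rw [map_add, diffSq_tmul, diffSq_tmul, diff_circTo_corolla_two (by omega) le_rfl,
        diff_circTo_corolla_two le_rfl (by omega), signOp_of_mem (hm 1), diff_corolla_three,
        map_sub, hc 1 le_rfl (by omega), hc 2 (by omega) le_rfl]
      simp [TensorProduct.sub_tmul, TensorProduct.tmul_sub]
  · have hx := diagonal_mem hδ (diff_mem_piece (corolla_mem_piece (K := K) n))
    obtain ⟨z, hz, hz'⟩ := exists_diffSq_eq (by omega) hx (by
      have h1 := eq_on_diff_corolla (f := diffSq K n ∘ₗ diagonal δ n)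
        (g := diagonal δ n ∘ₗ diff K n) fun T hT =>
          (diagonal_diff_gen hδ (diagonal_diff hδ h) T hT).symm
      rw [LinearMap.comp_apply, LinearMap.comp_apply, diff_diff, map_zero] at h1
      exact h1)
    exact ⟨z, by simpa using hz, hz'⟩

theorem oriented_of_lt_two {n : ℕ} (hn : n < 2) (l : List Edge) : oriented K n l = 0 :=
  oriented_of_not fun h => by
    have := h.two_le
    omega

theorem exists_corollaValue [CharZero K] (hδ : ∀ n : ℕ, δ n ∈ pieceSq K n (n - 2)) {n : ℕ}
    (h : ∀ k < n, IsCorollaValue δ k) :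
    ∃ z ∈ pieceSq K n (n - 2), diffSq K n z = diagonal δ n (diff K n (corolla K n)) ∧
      rotSq K n z = (-1 : K) ^ n • z ∧ (n = 2 → z = corolla K n ⊗ₜ[K] corolla K n) := by
  rcases Nat.lt_or_ge n 2 with hn | hn
  · refine ⟨0, Submodule.zero_mem _, ?_, by simp, by omega⟩
    rw [corolla, oriented_of_lt_two hn, map_zero, map_zero, map_zero]
  rcases hn.eq_or_lt with rfl | hn
  · refine ⟨corolla K 2 ⊗ₜ[K] corolla K 2, ?_, ?_, ?_, fun _ => rfl⟩
    · exact tmul_mem_pieceSq (by norm_num) corolla_two_mem corolla_two_mem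
    · simp [diffSq_tmul, diff_corolla_two]
    · simp [rotSq, rot_corolla]
  · obtain ⟨z, hz, hz'⟩ := exists_diffSq_eq_diagonal hδ hn h
    obtain ⟨z', h1, h2, h3⟩ := exists_rotSq_eq hz (by
      rw [hz']
      have h1 := eq_on_diff_corolla (f := rotSq K n ∘ₗ diagonal δ n)
        (g := diagonal δ n ∘ₗ rot K n) fun T hT =>
          (diagonal_rot_gen hδ (diagonal_rot hδ h) T hT).symm
      rw [LinearMap.comp_apply, LinearMap.comp_apply, ← diff_rot, rot_corolla, map_smul,
        map_smul] at h1
      exact h1)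
    exact ⟨z', h1, by rw [h2, hz'], h3, by omega⟩

theorem exists_update [CharZero K] (hδ : ∀ n : ℕ, δ n ∈ pieceSq K n (n - 2)) {n : ℕ}
    (h : ∀ k < n, IsCorollaValue δ k) :
    ∃ δ' : ∀ n, AInfSq K n, (∀ n : ℕ, δ' n ∈ pieceSq K n (n - 2)) ∧
      (∀ k < n + 1, IsCorollaValue δ' k) ∧ ∀ k < n, δ' k = δ k := by
  obtain ⟨z, h1, h2, h3, h4⟩ := exists_corollaValue hδ h
  have hne : ∀ k < n, Function.update δ n z k = δ k := fun k hk =>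
    Function.update_of_ne hk.ne _ _
  refine ⟨Function.update δ n z, fun k => ?_, fun k hk => ?_, hne⟩
  · rcases eq_or_ne k n with rfl | hk
    · rwa [Function.update_self]
    · rw [Function.update_of_ne hk]
      exact hδ k
  · rcases (Nat.lt_succ_iff.1 hk).eq_or_lt with rfl | hk
    · refine ⟨?_, ?_, ?_⟩ <;> rw [Function.update_self]
      · rw [h2]
        exact eq_on_diff_corolla fun T hT =>
          diagonal_congr_gen (fun j hj => (hne j hj).symm) T hT
      · exact h3
      · exact h4
    · exact (h k hk).congr fun j hj => (hne j (by omega)).symm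

variable (K) in
theorem exists_corollaValues [CharZero K] : ∃ δ : ∀ n, AInfSq K n,
    (∀ n : ℕ, δ n ∈ pieceSq K n (n - 2)) ∧ ∀ n, IsCorollaValue δ n := by
  -- A sequence of families, each of which satisfies the conditions at one more corolla.
  let X (n : ℕ) := {δ : ∀ n, AInfSq K n //
    (∀ n : ℕ, δ n ∈ pieceSq K n (n - 2)) ∧ ∀ k < n, IsCorollaValue δ k}
  have hstep : ∀ n (δ : X n), ∃ δ' : X (n + 1), ∀ k < n, δ'.1 k = δ.1 k := by
    rintro n ⟨δ, h1, h2⟩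
    obtain ⟨δ', h3, h4, h5⟩ := exists_update h1 h2
    exact ⟨⟨δ', h3, h4⟩, h5⟩
  choose step hs using hstep
  let f (n : ℕ) : X n := Nat.rec ⟨fun _ => 0, fun _ => Submodule.zero_mem _, by simp⟩ step n
  have hf : ∀ n k, k < n → ∀ j, (f (n + j)).1 k = (f n).1 k := by
    intro n k hk j
    induction j with
    | zero => rfl
    | succ j ih =>
      rw [← ih]
      exact hs (n + j) (f (n + j)) k (by omega)
  refine ⟨fun n => (f (n + 1)).1 n, fun n => (f (n + 1)).2.1 n, fun n => ?_⟩
  refine ((f (n + 1)).2.2 n (Nat.lt_succ_self n)).congr fun k hk => ?_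
  have := hf (k + 1) k (Nat.lt_succ_self k) (n - k)
  rwa [show k + 1 + (n - k) = n + 1 by omega] at this

/-! ### The cyclic diagonal -/

theorem iteratedProduct_mem_piece (n : ℕ) : iteratedProduct K n ∈ piece K n 0 := by
  match n with
  | 0 => exact Submodule.zero_mem _
  | 1 => exact Submodule.zero_mem _
  | 2 => exact corolla_two_mem
  | n + 3 =>
    have h := circTo_mem_piece (i := 1) (N := n + 3) rfl (iteratedProduct_mem_piece (n + 2))
      (corolla_two_mem (K := K))
    rwa [add_zero] at h

theorem diagonal_iteratedProduct (hδ : ∀ n : ℕ, δ n ∈ pieceSq K n (n - 2))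
    (h2 : δ 2 = corolla K 2 ⊗ₜ[K] corolla K 2) (n : ℕ) :
    diagonal δ n (iteratedProduct K n) = iteratedProduct K n ⊗ₜ[K] iteratedProduct K n := by
  match n with
  | 0 => simp [iteratedProduct]
  | 1 => simp [iteratedProduct]
  | 2 => rw [iteratedProduct, diagonal_corolla le_rfl, h2]
  | n + 3 =>
    have h := diagonal_circTo hδ (n + 3) (m := n + 2) (n := 2) (i := 1) rfl le_rfl (by omega)
      (iteratedProduct K (n + 2)) (corolla K 2)
    rw [diagonal_iteratedProduct hδ h2 (n + 2), diagonal_corolla le_rfl, h2,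
      circSqTo_tmul _ _ _ _ _ (iteratedProduct_mem_piece _) corolla_two_mem, mul_zero, zpow_zero,
      one_smul] at h
    exact h

theorem isCyclicDiagonal_diagonal [CharZero K] (hδ : ∀ n : ℕ, δ n ∈ pieceSq K n (n - 2))
    (h : ∀ n, IsCorollaValue δ n) : IsCyclicDiagonal (diagonal δ) where
  degree _ _ _ hx := diagonal_mem hδ hx
  comm_diff n x := diagonal_diff hδ (fun n _ => h n) n (Nat.lt_succ_self n) x
  comm_circ m n i hi him x y := diagonal_circTo hδ _ rfl hi him x y
  homology n _ := by
    refine LinearMap.ext_ring ?_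
    have h1 := diagonal_iteratedProduct hδ ((h 2).two rfl) n
    simp only [LinearMap.comp_apply, asToHomology, asDiagonal, LinearMap.toSpanSingleton_apply,
      one_smul, TensorProduct.map_tmul]
    rw [kunneth_mk]
    exact congrArg (Homology.mk (diffSq K n)) (Subtype.ext h1)
  comm_rot n x := diagonal_rot hδ (fun n _ => h n) n (Nat.lt_succ_self n) x

end

end AInfinity

theorem theorem3p3 (K : Type*) [Field K] [CharZero K] :
    ∃ Δ : ∀ n, AInfinity.AInf K n →ₗ[K] AInfinity.AInf K n ⊗[K] AInfinity.AInf K n,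
      AInfinity.IsCyclicDiagonal Δ := by
  obtain ⟨δ, hδ, h⟩ := AInfinity.exists_corollaValues K
  exact ⟨AInfinity.diagonal δ, AInfinity.isCyclicDiagonal_diagonal hδ h⟩
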